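/- For $\pi\in S_n$ let $d(\pi)=\#\{1\le i\le n-1:\pi(i)>\pi(i+1)\}$ be its number of descents. For a partition $\lambda$ of $n\ge 1$, let $\mathcal C_\lambda\subset S_n$ be the conjugacy class of permutations whose cycle lengths (fixed points included) are the parts of $\lambda$, let $m_1(\lambda)$ be the number of parts of $\lambda$ equal to $1$ (the number of fixed points of each element of $\mathcal C_\lambda$), and let $\pi$ be uniformly distributed on $\mathcal C_\lambda$. Define the random variable $W_\lambda$ by $$d(\pi)=\frac{n+1}{2}-\frac{m_1(\lambda)^2}{2n}+\sqrt n\,W_\lambda .$$ Let $(n_k)_{k\ge 0}$ be a sequence of positive integers with $n_k\to\infty$, let $\lambda^{(k)}$ be a partition of $n_k$ for each $k$, and suppose that $m_1(\lambda^{(k)})/n_k\to\alpha\in\mathbb R$ as $k\to\infty$. Then $W_{\lambda^{(k)}}$ converges in distribution, as $k\to\infty$, to the normal distribution $$\mathcal N\!\left(0,\ \frac{1-4\alpha^3+3\alpha^4}{12}\right),$$ understood as the point mass at $0$ when the variance is $0$ (that is, when $\alpha=1$). -/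

import Mathlib

/-- The descent set of `π ∈ S_n`: the positions `i` such that `i + 1` is also a position and
`π(i) > π(i + 1)`. Positions and values are numbered from `0`. -/
def descentSet {n : ℕ} (π : Equiv.Perm (Fin n)) : Finset (Fin n) :=
  {i : Fin n | ∃ h : (i : ℕ) + 1 < n, π ⟨(i : ℕ) + 1, h⟩ < π i}

/-- The descent number `d(π)`. -/
def descentNumber {n : ℕ} (π : Equiv.Perm (Fin n)) : ℕ :=
  (descentSet π).card

/-- The conjugacy class `C_p` of `S_n`: the permutations whose multiset of cycle lengths
(fixed points counted as cycles of length `1`) is the partition `p` of `n`. -/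
def cycleClass {n : ℕ} (p : n.Partition) : Set (Equiv.Perm (Fin n)) :=
  {π | π.partition.parts = p.parts}

/-- The number `m₁` of parts of `p` equal to `1`, i.e. of fixed points of each element
of `C_p`. -/
def numFixed {n : ℕ} (p : n.Partition) : ℕ :=
  p.parts.count 1

theorem cycleClass_nonempty {n : ℕ} (p : n.Partition) : (cycleClass p).Nonempty := by
  have hdec : p.parts.filter (2 ≤ ·) + Multiset.replicate (p.parts.count 1) 1 = p.parts := by
    have h1 : p.parts.filter (fun i => ¬ 2 ≤ i) = Multiset.replicate (p.parts.count 1) 1 := by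
      rw [← Multiset.filter_eq']
      refine Multiset.filter_congr fun x hx => ?_
      have := p.parts_pos hx
      omega
    rw [← h1, Multiset.filter_add_not]
  have hsum : (p.parts.filter (2 ≤ ·)).sum + p.parts.count 1 = n := by
    have h2 := congrArg Multiset.sum hdec
    simpa [p.parts_sum] using h2
  obtain ⟨g, hg⟩ := (Equiv.Perm.exists_with_cycleType_iff (Fin n)
    (m := p.parts.filter (2 ≤ ·))).2
      ⟨by rw [Fintype.card_fin]; omega, fun a ha => (Multiset.mem_filter.1 ha).2⟩
  refine ⟨g, ?_⟩
  have hs : g.support.card = (p.parts.filter (2 ≤ ·)).sum := by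
    rw [← hg, Equiv.Perm.sum_cycleType]
  have hc : Fintype.card (Fin n) - g.support.card = p.parts.count 1 := by
    rw [hs, Fintype.card_fin]; omega
  change g.partition.parts = p.parts
  rw [Equiv.Perm.parts_partition, hg, hc, hdec]

instance instMeasurableSpacePermFin (n : ℕ) : MeasurableSpace (Equiv.Perm (Fin n)) := ⊤

instance instDiscreteMeasurableSpacePermFin (n : ℕ) :
    DiscreteMeasurableSpace (Equiv.Perm (Fin n)) := ⟨fun _ => trivial⟩

/-- The law of a uniformly random element of the conjugacy class `C_p`. -/
noncomputable def uniformClass {n : ℕ} (p : n.Partition) :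
    MeasureTheory.Measure (Equiv.Perm (Fin n)) :=
  ProbabilityTheory.uniformOn (cycleClass p)

instance instIsProbabilityMeasureUniformClass {n : ℕ} (p : n.Partition) :
    MeasureTheory.IsProbabilityMeasure (uniformClass p) :=
  ProbabilityTheory.isProbabilityMeasure_uniformOn (Set.toFinite _) (cycleClass_nonempty p)

/-- The normalized descent number `W_p`, the solution of
`d(π) = (n + 1) / 2 - m₁ ^ 2 / (2 n) + √n * W_p(π)` (for `n ≥ 1`). -/
noncomputable def normDescents {n : ℕ} (p : n.Partition) (π : Equiv.Perm (Fin n)) : ℝ :=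
  ((descentNumber π : ℝ) - (((n : ℝ) + 1) / 2 - (numFixed p : ℝ) ^ 2 / (2 * (n : ℝ))))
    / Real.sqrt (n : ℝ)

/-!
Fix `τ` with cycle type `p`. Pairs of a colouring of the points of `τ` by `a` letters and a
compatible linear order on the points can be counted in two ways. Sorting the points by the order
turns a pair into a conjugate `π` of `τ` and a monotone word that strictly increases wherever `π`
descends, so there are `(a + n - 1 - d(π)).choose n` words for each `π`. Inserting the cycles of `τ`
one at a time, a new `l`-cycle either spells an arbitrary primitive word of length `l`, below all
points with the same word, or is a copy placed just above one of the `l * j` points on the earlier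
`l`-cycles. Comparing the counts for all `a` gives the polynomial identity
`𝔼 ∏ k < n, (z + k - d(π)) = ∏ l, ∏ j < m_l, (P_l(z) + l * j)`, with `P_l` the number of primitive
words of length `l` in `z` letters.

At `z = n * b / (i * s)`, after division by `z ^ n`, only the factors with `l = 1` survive in the
limit, and a second-order expansion of the logarithms turns both sides into explicit exponentials.
The left-hand exponent contains the square of the centred number of ascents. Taking `b = n` shows
that this number divided by `n` concentrates at `α ^ 2 / 2`, so for `b = √n` the square may be
replaced by a constant, and the limit of the characteristic functions follows.
-/

section Combinatorics

open Function Polynomial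

variable {X Y Z A : Type*}

section Iteration

theorem iterate_eq_iterate_iff_mod {f : X → X} {x : X} (hpos : 0 < minimalPeriod f x) {i j : ℕ} :
    f^[i] x = f^[j] x ↔ i % minimalPeriod f x = j % minimalPeriod f x := by
  rw [← iterate_mod_minimalPeriod_eq (n := i), ← iterate_mod_minimalPeriod_eq (n := j)]
  exact iterate_eq_iterate_iff_of_lt_minimalPeriod (Nat.mod_lt _ hpos) (Nat.mod_lt _ hpos)

theorem iterate_eq_iterate_iff_of_minimalPeriod_eq {f : X → X} {g : Y → Y} {x : X} {y : Y}
    (h : minimalPeriod f x = minimalPeriod g y) (hpos : 0 < minimalPeriod g y) {i j : ℕ} :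
    f^[i] x = f^[j] x ↔ g^[i] y = g^[j] y := by
  rw [iterate_eq_iterate_iff_mod (h ▸ hpos), iterate_eq_iterate_iff_mod hpos, h]

theorem minimalPeriod_apply_of_semiconj {φ : X → Y} {f : X → X} {g : Y → Y}
    (h : Semiconj φ f g) (hφ : Injective φ) (x : X) :
    minimalPeriod g (φ x) = minimalPeriod f x := by
  refine minimalPeriod_eq_minimalPeriod_iff.2 fun n => ?_
  rw [IsPeriodicPt, IsFixedPt, ← (h.iterate_right n).eq, hφ.eq_iff, IsPeriodicPt, IsFixedPt]

theorem semiconj_inl (τ : Y → Y) (ρ : Z → Z) : Semiconj Sum.inl τ (Sum.map τ ρ) := fun _ => rfl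

theorem semiconj_inr (τ : Y → Y) (ρ : Z → Z) : Semiconj Sum.inr ρ (Sum.map τ ρ) := fun _ => rfl

end Iteration

section Rank

/-- The number of predecessors of `y` under the relation `r`. For a strict total order on a finite
type this is the order isomorphism onto an initial segment of `ℕ`. -/
noncomputable def relRank (r : Y → Y → Prop) (y : Y) : ℕ := {x | r x y}.ncard

theorem rel_eq_of_le {r s : Y → Y → Prop} [Std.Asymm s] [Std.Trichotomous r]
    (h : ∀ x y, r x y → s x y) : r = s := by
  funext x y
  refine propext ⟨h x y, fun hs => ?_⟩
  rcases trichotomous_of r x y with hr | rfl | hr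
  · exact hr
  · exact absurd hs (irrefl_of s x)
  · exact absurd (h y x hr) (asymm_of s hs)

variable [Finite Y] {r : Y → Y → Prop}

theorem relRank_lt_of_rel [IsStrictOrder Y r] {x y : Y} (hxy : r x y) :
    relRank r x < relRank r y :=
  Set.ncard_lt_ncard ⟨fun _ hz => trans_of r hz hxy, fun hs => irrefl_of r x (hs hxy)⟩
    (Set.toFinite _)

theorem relRank_lt_iff [IsStrictTotalOrder Y r] {x y : Y} :
    relRank r x < relRank r y ↔ r x y := by
  have hr : r = fun x y => relRank r x < relRank r y :=
    rel_eq_of_le fun _ _ => relRank_lt_of_rel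
  exact (iff_of_eq (congrFun₂ hr x y)).symm

theorem relRank_injective [IsStrictTotalOrder Y r] : Injective (relRank r) := by
  intro x y hxy
  rcases trichotomous_of r x y with hlt | heq | hlt
  · exact absurd hxy (relRank_lt_of_rel hlt).ne
  · exact heq
  · exact absurd hxy (relRank_lt_of_rel hlt).ne'

end Rank

section Admissible

/-- The sequence of colours met by the iterates of `x` under `τ`. -/
def colourWord (τ : X → X) (f : X → A) (x : X) : ℕ → A := fun j => f (τ^[j] x)

/-- The shift map on sequences. -/
def seqShift (s : ℕ → A) : ℕ → A := fun j => s (j + 1)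

theorem seqShift_iterate (s : ℕ → A) (k : ℕ) : seqShift^[k] s = fun j => s (j + k) := by
  induction k with
  | zero => rfl
  | succ k ih =>
    funext j
    rw [iterate_succ_apply', ih, seqShift, Nat.add_right_comm, Nat.add_assoc]

theorem semiconj_colourWord (τ : X → X) (f : X → A) : Semiconj (colourWord τ f) τ seqShift :=
  fun _ => rfl

theorem colourWord_iterate (τ : X → X) (f : X → A) (k : ℕ) (x : X) :
    colourWord τ f (τ^[k] x) = seqShift^[k] (colourWord τ f x) :=
  (semiconj_colourWord τ f).iterate_right k x

theorem colourWord_apply_of_semiconj {φ : X → Y} {τ : X → X} {σ : Y → Y} (h : Semiconj φ τ σ)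
    (f : Y → A) (x : X) : colourWord σ f (φ x) = colourWord τ (f ∘ φ) x :=
  funext fun j => congrArg f ((h.iterate_right j).eq x).symm

theorem colourWord_inl (τ : Y → Y) (ρ : Z → Z) (f : Y ⊕ Z → A) (y : Y) :
    colourWord (Sum.map τ ρ) f (Sum.inl y) = colourWord τ (f ∘ Sum.inl) y :=
  colourWord_apply_of_semiconj (semiconj_inl τ ρ) f y

theorem colourWord_inr (τ : Y → Y) (ρ : Z → Z) (f : Y ⊕ Z → A) (z : Z) :
    colourWord (Sum.map τ ρ) f (Sum.inr z) = colourWord ρ (f ∘ Sum.inr) z :=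
  colourWord_apply_of_semiconj (semiconj_inr τ ρ) f z

variable [LinearOrder A]

theorem toLex_seqShift_lt {s t : ℕ → A} (h : toLex s < toLex t) (h₀ : s 0 = t 0) :
    toLex (seqShift s) < toLex (seqShift t) := by
  obtain ⟨i, heq, hlt⟩ := h
  obtain _ | i := i
  · exact absurd h₀ hlt.ne
  · exact ⟨i, fun j hj => heq (j + 1) (Nat.succ_lt_succ hj), hlt⟩

theorem apply_zero_le_of_toLex_lt {s t : ℕ → A} (h : toLex s < toLex t) : s 0 ≤ t 0 := by
  obtain ⟨i, heq, hlt⟩ := h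
  obtain _ | i := i
  · exact hlt.le
  · exact (heq 0 (Nat.succ_pos i)).le

/-- A colouring `f` and a strict total order `r` on `X` are compatible with `τ` if colours increase
weakly along `r` and `τ` preserves `r` between elements of equal colour. -/
structure IsAdmissible (τ : X → X) (f : X → A) (r : X → X → Prop) : Prop
    extends IsStrictTotalOrder X r where
  mono : ∀ {x y}, r x y → f x ≤ f y
  step : ∀ {x y}, r x y → f x = f y → r (τ x) (τ y)

/-- The pairs of a colouring by `A` and an order compatible with `τ`. Counting them in two ways,
cycle by cycle and order by order, gives the descent generating function of a conjugacy class. -/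
def AdmissiblePair (A : Type*) [LinearOrder A] (τ : X → X) :=
  {q : (X → A) × (X → X → Prop) // IsAdmissible τ q.1 q.2}

namespace IsAdmissible

variable {τ : X → X} {f : X → A} {r : X → X → Prop}

theorem rel_iterate_of_forall_lt (h : IsAdmissible τ f r) {x y : X} (hxy : r x y) {k : ℕ}
    (hw : ∀ j < k, colourWord τ f x j = colourWord τ f y j) : r (τ^[k] x) (τ^[k] y) := by
  induction k with
  | zero => exact hxy
  | succ k ih =>
    rw [iterate_succ_apply', iterate_succ_apply']
    exact h.step (ih fun j hj => hw j (Nat.lt_succ_of_lt hj)) (hw k (Nat.lt_succ_self k))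

theorem rel_iterate (h : IsAdmissible τ f r) {x y : X} (hxy : r x y)
    (hw : colourWord τ f x = colourWord τ f y) (k : ℕ) : r (τ^[k] x) (τ^[k] y) :=
  h.rel_iterate_of_forall_lt hxy fun j _ => congrFun hw j

theorem rel_iterate_iff (h : IsAdmissible τ f r) {x y : X}
    (hw : colourWord τ f x = colourWord τ f y) (k : ℕ) : r (τ^[k] x) (τ^[k] y) ↔ r x y := by
  have := h.toIsStrictTotalOrder
  refine ⟨fun hk => ?_, fun hxy => h.rel_iterate hxy hw k⟩
  rcases trichotomous_of r x y with hr | rfl | hr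
  · exact hr
  · exact absurd hk (irrefl_of r _)
  · exact absurd (h.rel_iterate hr hw.symm k) (asymm_of r hk)

theorem toLex_colourWord_le (h : IsAdmissible τ f r) {x y : X} (hxy : r x y) :
    toLex (colourWord τ f x) ≤ toLex (colourWord τ f y) := by
  by_contra hlt
  obtain ⟨i, heq, hlt⟩ := not_le.1 hlt
  exact (h.mono (h.rel_iterate_of_forall_lt hxy fun j hj => (heq j hj).symm)).not_gt hlt

theorem rel_of_toLex_colourWord_lt (h : IsAdmissible τ f r) {x y : X}
    (hxy : toLex (colourWord τ f x) < toLex (colourWord τ f y)) : r x y := by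
  have := h.toIsStrictTotalOrder
  rcases trichotomous_of r x y with hr | rfl | hr
  · exact hr
  · exact absurd hxy (lt_irrefl _)
  · exact absurd hxy (h.toLex_colourWord_le hr).not_gt

-- If `τ^[k] x` and `x` spelled the same word but were distinct, the points `τ^[k * i] x` would form
-- a strictly monotone sequence, contradicting periodicity.
theorem iterate_eq_of_colourWord_eq (h : IsAdmissible τ f r) {x : X} (hx : x ∈ periodicPts τ)
    {k : ℕ} (hk : colourWord τ f (τ^[k] x) = colourWord τ f x) : τ^[k] x = x := by
  have := h.toIsStrictTotalOrder
  obtain ⟨p, hp, hper⟩ := hx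
  have hiter (i : ℕ) : τ^[k * i] (τ^[k] x) = τ^[k * (i + 1)] x := by
    rw [← iterate_add_apply, Nat.mul_succ]
  have hreturn : τ^[k * p] x = τ^[k * 0] x := hper.const_mul k
  rcases trichotomous_of r (τ^[k] x) x with hr | heq | hr
  · have hdecr := Nat.rel_of_forall_rel_succ_of_lt (swap r) (f := fun i => τ^[k * i] x)
      (fun i => hiter i ▸ h.rel_iterate hr hk (k * i)) hp
    exact absurd (hreturn ▸ hdecr) (irrefl_of r _)
  · exact heq
  · have hincr := Nat.rel_of_forall_rel_succ_of_lt r (f := fun i => τ^[k * i] x)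
      (fun i => hiter i ▸ h.rel_iterate hr hk.symm (k * i)) hp
    exact absurd (hreturn ▸ hincr) (irrefl_of r _)

theorem minimalPeriod_colourWord (h : IsAdmissible τ f r) {x : X} (hx : x ∈ periodicPts τ) :
    minimalPeriod seqShift (colourWord τ f x) = minimalPeriod τ x := by
  refine minimalPeriod_eq_minimalPeriod_iff.2 fun k => ⟨fun hk => ?_, fun hk => ?_⟩
  · exact h.iterate_eq_of_colourWord_eq hx ((colourWord_iterate τ f k x).trans hk)
  · exact hk.map (semiconj_colourWord τ f)

theorem comp_semiconj {φ : X → Y} {τ : X → X} {σ : Y → Y} {F : Y → A} {R : Y → Y → Prop}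
    (h : IsAdmissible σ F R) (hφ : Semiconj φ τ σ) (hinj : Injective φ) :
    IsAdmissible τ (F ∘ φ) (R on φ) where
  toIsStrictTotalOrder :=
    have := h.toIsStrictTotalOrder
    (⟨⟨φ, hinj⟩, Iff.rfl⟩ : (R on φ) ↪r R).isStrictTotalOrder
  mono hxy := h.mono hxy
  step {x y} hxy heq := by
    rw [onFun, hφ.eq, hφ.eq]
    exact h.step hxy heq

end IsAdmissible

/-- The order on `X` by colour words, ties being broken by heights. -/
def wordHeightRel (τ : X → X) (f : X → A) (height : X → ℕ) (x y : X) : Prop :=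
  toLex (toLex (colourWord τ f x), height x) < toLex (toLex (colourWord τ f y), height y)

theorem wordHeightRel_iff {τ : X → X} {f : X → A} {height : X → ℕ} {x y : X} :
    wordHeightRel τ f height x y ↔ toLex (colourWord τ f x) < toLex (colourWord τ f y) ∨
      colourWord τ f x = colourWord τ f y ∧ height x < height y := by
  rw [wordHeightRel, Prod.Lex.toLex_lt_toLex, toLex_inj]

theorem isAdmissible_wordHeightRel {τ : X → X} {f : X → A} {height : X → ℕ}
    (hinj : ∀ x y, colourWord τ f x = colourWord τ f y → height x = height y → x = y)
    (hstep : ∀ x y, colourWord τ f x = colourWord τ f y → height x < height y →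
      height (τ x) < height (τ y)) :
    IsAdmissible τ f (wordHeightRel τ f height) where
  toIsStrictTotalOrder := by
    have hkey : Injective fun x => toLex (toLex (colourWord τ f x), height x) := fun x y hxy =>
      have hxy := Prod.ext_iff.1 (toLex_inj.1 hxy)
      hinj x y (toLex_inj.1 hxy.1) hxy.2
    exact (⟨⟨_, hkey⟩, Iff.rfl⟩ : wordHeightRel τ f height ↪r (· < ·)).isStrictTotalOrder
  mono hxy := by
    rcases wordHeightRel_iff.1 hxy with hlt | ⟨heq, -⟩
    · exact apply_zero_le_of_toLex_lt hlt
    · exact (congrFun heq 0).le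
  step {x y} hxy h₀ := by
    rw [wordHeightRel_iff, (semiconj_colourWord τ f).eq, (semiconj_colourWord τ f).eq]
    rcases wordHeightRel_iff.1 hxy with hlt | ⟨heq, hlt⟩
    · exact Or.inl (toLex_seqShift_lt hlt h₀)
    · exact Or.inr ⟨congrArg seqShift heq, hstep x y heq hlt⟩

end Admissible

section Extension

/-- `ρ` is a single cycle, all of whose elements are reached from the base point `z₀`. -/
structure IsSingleCycle (ρ : Z → Z) (z₀ : Z) : Prop where
  mem_periodicPts : z₀ ∈ periodicPts ρ
  exists_iterate_eq : ∀ z, ∃ j : ℕ, ρ^[j] z₀ = z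

namespace IsSingleCycle

variable {ρ : Z → Z} {z₀ : Z}

theorem minimalPeriod_pos (hρ : IsSingleCycle ρ z₀) : 0 < minimalPeriod ρ z₀ :=
  minimalPeriod_pos_of_mem_periodicPts hρ.mem_periodicPts

theorem exists_iterate_eq_base (hρ : IsSingleCycle ρ z₀) (z : Z) : ∃ k : ℕ, ρ^[k] z = z₀ := by
  obtain ⟨j, rfl⟩ := hρ.exists_iterate_eq z
  refine ⟨minimalPeriod ρ z₀ * j - j, ?_⟩
  rw [← iterate_add_apply, Nat.sub_add_cancel (Nat.le_mul_of_pos_left j hρ.minimalPeriod_pos)]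
  exact (isPeriodicPt_minimalPeriod ρ z₀).mul_const j

variable (hρ : IsSingleCycle ρ z₀)

/-- The map from the cycle `ρ` that intertwines `ρ` with `g` and takes the base point to `x`; this
is meaningful when `x` has the same minimal period as the base point. -/
noncomputable def orbitMap (g : X → X) (x : X) (z : Z) : X :=
  g^[(hρ.exists_iterate_eq z).choose] x

section OrbitMap

variable {g : X → X} {x : X}

theorem orbitMap_iterate (hx : minimalPeriod g x = minimalPeriod ρ z₀) (j : ℕ) :
    hρ.orbitMap g x (ρ^[j] z₀) = g^[j] x :=
  (iterate_eq_iterate_iff_of_minimalPeriod_eq hx hρ.minimalPeriod_pos).2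
    (hρ.exists_iterate_eq (ρ^[j] z₀)).choose_spec

theorem orbitMap_base (hx : minimalPeriod g x = minimalPeriod ρ z₀) : hρ.orbitMap g x z₀ = x :=
  hρ.orbitMap_iterate hx 0

theorem semiconj_orbitMap (hx : minimalPeriod g x = minimalPeriod ρ z₀) :
    Semiconj (hρ.orbitMap g x) ρ g := by
  intro z
  obtain ⟨j, rfl⟩ := hρ.exists_iterate_eq z
  rw [← iterate_succ_apply' ρ, hρ.orbitMap_iterate hx, hρ.orbitMap_iterate hx, iterate_succ_apply']

theorem orbitMap_injective (hx : minimalPeriod g x = minimalPeriod ρ z₀) :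
    Injective (hρ.orbitMap g x) := by
  intro z z' h
  obtain ⟨i, rfl⟩ := hρ.exists_iterate_eq z
  obtain ⟨j, rfl⟩ := hρ.exists_iterate_eq z'
  rw [hρ.orbitMap_iterate hx, hρ.orbitMap_iterate hx] at h
  exact (iterate_eq_iterate_iff_of_minimalPeriod_eq hx hρ.minimalPeriod_pos).1 h

theorem map_orbitMap {φ : X → Y} {g' : Y → Y} (hφ : Semiconj φ g g') (z : Z) :
    φ (hρ.orbitMap g x z) = hρ.orbitMap g' (φ x) z :=
  (hφ.iterate_right _).eq x

theorem orbitMap_self (z : Z) : hρ.orbitMap ρ z₀ z = z :=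
  (hρ.exists_iterate_eq z).choose_spec

end OrbitMap

/-- The colouring of the cycle that spells the sequence `s` from the base point. -/
noncomputable def spellColour (s : ℕ → A) (z : Z) : A := hρ.orbitMap seqShift s z 0

theorem colourWord_spellColour {s : ℕ → A} (hs : minimalPeriod seqShift s = minimalPeriod ρ z₀)
    (z : Z) : colourWord ρ (hρ.spellColour s) z = hρ.orbitMap seqShift s z := by
  refine (colourWord_apply_of_semiconj (hρ.semiconj_orbitMap hs) (fun t => t 0) z).symm.trans ?_
  funext j
  simp only [colourWord, seqShift_iterate, Nat.zero_add]

theorem spellColour_colourWord (f : Z → A) : hρ.spellColour (colourWord ρ f z₀) = f := by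
  funext z
  rw [spellColour, ← hρ.map_orbitMap (semiconj_colourWord ρ f), hρ.orbitMap_self]
  rfl

end IsSingleCycle

/-- The ways to insert a new cycle of length `l` into an admissible pair for `τ`: the new cycle
either spells a primitive sequence and lies below all elements with the same word, or it copies the
cycle of an element `y` of period `l`, its base point being placed just above `y`. -/
abbrev CycleInsertion (A : Type*) (τ : Y → Y) (l : ℕ) : Type _ :=
  {s : ℕ → A // minimalPeriod seqShift s = l} ⊕ {y : Y // minimalPeriod τ y = l}

/-- The sequence spelled from the base point of an inserted cycle. -/
def insertionWord {τ : Y → Y} (f : Y → A) {l : ℕ} : CycleInsertion A τ l → ℕ → A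
  | Sum.inl s => s
  | Sum.inr y => colourWord τ f y

variable {τ : Y → Y} {ρ : Z → Z} {z₀ : Z} (hρ : IsSingleCycle ρ z₀)

/-- The colouring extended to an inserted cycle. -/
noncomputable def extColour (f : Y → A) (c : CycleInsertion A τ (minimalPeriod ρ z₀)) :
    Y ⊕ Z → A :=
  Sum.elim f (hρ.spellColour (insertionWord f c))

/-- The heights that order elements with equal words after the insertion of a cycle: old elements
have odd heights, and each new element has the even height just above that of the element it copies,
or height `0` if it copies none. -/
noncomputable def extHeight (r : Y → Y → Prop) (c : CycleInsertion A τ (minimalPeriod ρ z₀)) :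
    Y ⊕ Z → ℕ
  | Sum.inl y => 2 * relRank r y + 1
  | Sum.inr z =>
    match c with
    | Sum.inl _ => 0
    | Sum.inr y₀ => 2 * relRank r (hρ.orbitMap τ y₀ z) + 2

theorem colourWord_extColour_inl (f : Y → A) (c : CycleInsertion A τ (minimalPeriod ρ z₀)) (y : Y) :
    colourWord (Sum.map τ ρ) (extColour hρ f c) (Sum.inl y) = colourWord τ f y :=
  colourWord_inl τ ρ _ y

theorem mem_periodicPts_inr (hρ : IsSingleCycle ρ z₀) (τ : Y → Y) (z : Z) :
    (Sum.inr z : Y ⊕ Z) ∈ periodicPts (Sum.map τ ρ) := by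
  obtain ⟨j, rfl⟩ := hρ.exists_iterate_eq z
  obtain ⟨p, hp, hper⟩ := hρ.mem_periodicPts
  exact ⟨p, hp, (hper.apply_iterate j).map (semiconj_inr τ ρ)⟩

variable [LinearOrder A]

/-- The order extended to an inserted cycle. -/
noncomputable def extRel (f : Y → A) (r : Y → Y → Prop)
    (c : CycleInsertion A τ (minimalPeriod ρ z₀)) : Y ⊕ Z → Y ⊕ Z → Prop :=
  wordHeightRel (Sum.map τ ρ) (extColour hρ f c) (extHeight hρ r c)

section Restriction

variable {F : Y ⊕ Z → A} {R R' : Y ⊕ Z → Y ⊕ Z → Prop}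

theorem IsAdmissible.restrict (h : IsAdmissible (Sum.map τ ρ) F R) :
    IsAdmissible τ (F ∘ Sum.inl) (R on Sum.inl) :=
  h.comp_semiconj (semiconj_inl τ ρ) Sum.inl_injective

theorem IsAdmissible.colourWord_inr_injective (h : IsAdmissible (Sum.map τ ρ) F R)
    (hρ : IsSingleCycle ρ z₀) {z z' : Z}
    (hw : colourWord (Sum.map τ ρ) F (Sum.inr z) = colourWord (Sum.map τ ρ) F (Sum.inr z')) :
    z = z' := by
  obtain ⟨k, hk⟩ := hρ.exists_iterate_eq_base z'
  obtain ⟨j, rfl⟩ := hρ.exists_iterate_eq z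
  have hjk : (Sum.map τ ρ)^[j + k] (Sum.inr z') = Sum.inr (ρ^[j] z₀) := by
    rw [← ((semiconj_inr τ ρ).iterate_right (j + k)).eq, iterate_add_apply, hk]
  have heq := h.iterate_eq_of_colourWord_eq (mem_periodicPts_inr hρ τ z') (hjk ▸ hw)
  exact Sum.inr_injective (hjk.symm.trans heq)

theorem IsAdmissible.rel_inl_inr_iff_base (h : IsAdmissible (Sum.map τ ρ) F R) {y : Y} {z : Z}
    (hw : colourWord (Sum.map τ ρ) F (Sum.inl y) = colourWord (Sum.map τ ρ) F (Sum.inr z)) {k : ℕ}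
    (hk : ρ^[k] z = z₀) :
    R (Sum.inl y) (Sum.inr z) ↔ R (Sum.inl (τ^[k] y)) (Sum.inr z₀) := by
  rw [← h.rel_iterate_iff hw k, ← ((semiconj_inl τ ρ).iterate_right k).eq,
    ← ((semiconj_inr τ ρ).iterate_right k).eq, hk]

theorem IsAdmissible.rel_inl_inr_iff_of_base (hρ : IsSingleCycle ρ z₀)
    (h : IsAdmissible (Sum.map τ ρ) F R) (h' : IsAdmissible (Sum.map τ ρ) F R')
    (hbase : ∀ y, colourWord τ (F ∘ Sum.inl) y = colourWord ρ (F ∘ Sum.inr) z₀ →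
      (R (Sum.inl y) (Sum.inr z₀) ↔ R' (Sum.inl y) (Sum.inr z₀))) {y : Y} {z : Z}
    (hw : colourWord (Sum.map τ ρ) F (Sum.inl y) = colourWord (Sum.map τ ρ) F (Sum.inr z)) :
    R (Sum.inl y) (Sum.inr z) ↔ R' (Sum.inl y) (Sum.inr z) := by
  obtain ⟨k, hk⟩ := hρ.exists_iterate_eq_base z
  rw [h.rel_inl_inr_iff_base hw hk, h'.rel_inl_inr_iff_base hw hk]
  refine hbase _ ?_
  rw [colourWord_iterate, ← colourWord_inl τ ρ, hw, colourWord_inr, ← colourWord_iterate, hk]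

theorem IsAdmissible.rel_eq_of_base (hρ : IsSingleCycle ρ z₀)
    (h : IsAdmissible (Sum.map τ ρ) F R) (h' : IsAdmissible (Sum.map τ ρ) F R')
    (hinl : (R on Sum.inl) = (R' on Sum.inl))
    (hbase : ∀ y, colourWord τ (F ∘ Sum.inl) y = colourWord ρ (F ∘ Sum.inr) z₀ →
      (R (Sum.inl y) (Sum.inr z₀) ↔ R' (Sum.inl y) (Sum.inr z₀))) : R = R' := by
  have := h.toIsStrictTotalOrder
  have := h'.toIsStrictTotalOrder
  refine rel_eq_of_le fun x x' hxx' => ?_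
  rcases (h.toLex_colourWord_le hxx').lt_or_eq with hlt | heq
  · exact h'.rel_of_toLex_colourWord_lt hlt
  have hw := toLex_inj.1 heq
  match x, x' with
  | Sum.inl y, Sum.inl y' => exact (congrFun₂ hinl y y').mp hxx'
  | Sum.inl y, Sum.inr z => exact (h.rel_inl_inr_iff_of_base hρ h' hbase hw).1 hxx'
  | Sum.inr z, Sum.inl y =>
    rcases trichotomous_of R' (Sum.inr z) (Sum.inl y) with hr | heq | hr
    · exact hr
    · exact absurd heq Sum.inr_ne_inl
    · exact absurd ((h.rel_inl_inr_iff_of_base hρ h' hbase hw.symm).2 hr) (asymm_of R hxx')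
  | Sum.inr z, Sum.inr z' =>
    rw [h.colourWord_inr_injective hρ hw] at hxx'
    exact absurd hxx' (irrefl_of R _)

end Restriction

variable {f : Y → A} {r : Y → Y → Prop}

theorem minimalPeriod_insertionWord (hρ : IsSingleCycle ρ z₀)
    (c : CycleInsertion A τ (minimalPeriod ρ z₀)) (h : IsAdmissible τ f r) :
    minimalPeriod seqShift (insertionWord f c) = minimalPeriod ρ z₀ := by
  rcases c with s | ⟨y, hy⟩
  · exact s.2
  · have hper : y ∈ periodicPts τ := by
      rw [← minimalPeriod_pos_iff_mem_periodicPts, hy]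
      exact hρ.minimalPeriod_pos
    rw [insertionWord, h.minimalPeriod_colourWord hper, hy]

variable (c : CycleInsertion A τ (minimalPeriod ρ z₀))

theorem colourWord_extColour_inr (h : IsAdmissible τ f r) (z : Z) :
    colourWord (Sum.map τ ρ) (extColour hρ f c) (Sum.inr z) =
      hρ.orbitMap seqShift (insertionWord f c) z :=
  (colourWord_inr τ ρ _ z).trans
    (hρ.colourWord_spellColour (minimalPeriod_insertionWord hρ c h) z)

theorem colourWord_extColour_inr_copy (h : IsAdmissible τ f r)
    (y₀ : {y : Y // minimalPeriod τ y = minimalPeriod ρ z₀}) (z : Z) :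
    colourWord (Sum.map τ ρ) (extColour hρ f (Sum.inr y₀)) (Sum.inr z) =
      colourWord τ f (hρ.orbitMap τ y₀ z) :=
  (colourWord_extColour_inr hρ _ h z).trans
    (hρ.map_orbitMap (semiconj_colourWord τ f) z).symm

theorem extRel_inl_base_iff (h : IsAdmissible τ f r) {y : Y}
    (hy : colourWord τ f y = insertionWord f c) :
    extRel hρ f r c (Sum.inl y) (Sum.inr z₀) ↔
      ∃ y₀, c = Sum.inr y₀ ∧ relRank r y ≤ relRank r y₀ := by
  rw [extRel, wordHeightRel_iff, colourWord_extColour_inl, colourWord_extColour_inr hρ c h,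
    hρ.orbitMap_base (minimalPeriod_insertionWord hρ c h), hy]
  refine (or_iff_right (lt_irrefl (toLex (insertionWord f c)))).trans ?_
  rcases c with s | y₀
  · simp [extHeight]
  · simp only [extHeight, true_and, hρ.orbitMap_base y₀.2, Sum.inr.injEq,
      exists_eq_left']
    omega

variable [Finite Y]

theorem extHeight_injOn_colourWord (h : IsAdmissible τ f r) (x x' : Y ⊕ Z)
    (hw : colourWord (Sum.map τ ρ) (extColour hρ f c) x =
      colourWord (Sum.map τ ρ) (extColour hρ f c) x')
    (heq : extHeight hρ r c x = extHeight hρ r c x') : x = x' := by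
  have := h.toIsStrictTotalOrder
  match x, x' with
  | Sum.inl y, Sum.inl y' =>
    simp only [extHeight] at heq
    exact congrArg Sum.inl (relRank_injective (r := r) (by omega))
  | Sum.inl y, Sum.inr z => cases c <;> simp only [extHeight] at heq <;> omega
  | Sum.inr z, Sum.inl y => cases c <;> simp only [extHeight] at heq <;> omega
  | Sum.inr z, Sum.inr z' =>
    rw [colourWord_extColour_inr hρ c h, colourWord_extColour_inr hρ c h] at hw
    exact congrArg Sum.inr (hρ.orbitMap_injective (minimalPeriod_insertionWord hρ c h) hw)

theorem IsAdmissible.relRank_apply_lt (h : IsAdmissible τ f r) {x y : Y}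
    (hw : colourWord τ f x = colourWord τ f y) (hlt : relRank r x < relRank r y) :
    relRank r (τ x) < relRank r (τ y) :=
  have := h.toIsStrictTotalOrder
  relRank_lt_iff.2 (h.step (relRank_lt_iff.1 hlt) (congrFun hw 0))

theorem IsAdmissible.relRank_apply_le (h : IsAdmissible τ f r) {x y : Y}
    (hw : colourWord τ f x = colourWord τ f y) (hle : relRank r x ≤ relRank r y) :
    relRank r (τ x) ≤ relRank r (τ y) := by
  have := h.toIsStrictTotalOrder
  rcases hle.lt_or_eq with hlt | heq
  · exact (h.relRank_apply_lt hw hlt).le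
  · rw [relRank_injective heq]

theorem extHeight_map_lt (h : IsAdmissible τ f r) (x x' : Y ⊕ Z)
    (hw : colourWord (Sum.map τ ρ) (extColour hρ f c) x =
      colourWord (Sum.map τ ρ) (extColour hρ f c) x')
    (hlt : extHeight hρ r c x < extHeight hρ r c x') :
    extHeight hρ r c (Sum.map τ ρ x) < extHeight hρ r c (Sum.map τ ρ x') := by
  match c, x, x' with
  | c, Sum.inl y, Sum.inl y' =>
    rw [colourWord_extColour_inl, colourWord_extColour_inl] at hw
    simp only [extHeight, Sum.map_inl] at hlt ⊢
    have := h.relRank_apply_lt hw (by omega)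
    omega
  | Sum.inl _, Sum.inl y, Sum.inr _ => exact absurd hlt (Nat.not_lt_zero _)
  | Sum.inl _, Sum.inr _, Sum.inl y => exact Nat.succ_pos _
  | Sum.inr y₀, Sum.inl y, Sum.inr z =>
    rw [colourWord_extColour_inl, colourWord_extColour_inr_copy hρ h] at hw
    simp only [extHeight, Sum.map_inl, Sum.map_inr] at hlt ⊢
    have := h.relRank_apply_le hw (by omega)
    rw [(hρ.semiconj_orbitMap y₀.2).eq]
    omega
  | Sum.inr y₀, Sum.inr z, Sum.inl y =>
    rw [colourWord_extColour_inl, colourWord_extColour_inr_copy hρ h] at hw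
    simp only [extHeight, Sum.map_inl, Sum.map_inr] at hlt ⊢
    have := h.relRank_apply_lt hw (by omega)
    rw [(hρ.semiconj_orbitMap y₀.2).eq]
    omega
  | c, Sum.inr z, Sum.inr z' =>
    rw [colourWord_extColour_inr hρ c h, colourWord_extColour_inr hρ c h] at hw
    rw [hρ.orbitMap_injective (minimalPeriod_insertionWord hρ c h) hw] at hlt
    exact absurd hlt (lt_irrefl _)

theorem isAdmissible_extRel (h : IsAdmissible τ f r) :
    IsAdmissible (Sum.map τ ρ) (extColour hρ f c) (extRel hρ f r c) :=
  isAdmissible_wordHeightRel (extHeight_injOn_colourWord hρ c h) (extHeight_map_lt hρ c h)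

theorem extRel_on_inl (h : IsAdmissible τ f r) : (extRel hρ f r c on Sum.inl) = r := by
  have := h.toIsStrictTotalOrder
  have := (isAdmissible_extRel hρ c h).restrict.toIsStrictTotalOrder
  refine (rel_eq_of_le fun y y' hr => ?_).symm
  rw [onFun, extRel, wordHeightRel_iff, colourWord_extColour_inl, colourWord_extColour_inl]
  rcases (h.toLex_colourWord_le hr).lt_or_eq with hlt | heq
  · exact Or.inl hlt
  · have := relRank_lt_iff.2 hr
    exact Or.inr ⟨toLex_inj.1 heq, by simp only [extHeight]; omega⟩

theorem insertion_eq_of_extRel_eq (h : IsAdmissible τ f r)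
    {c c' : CycleInsertion A τ (minimalPeriod ρ z₀)}
    (hword : insertionWord f c = insertionWord f c')
    (hrel : extRel hρ f r c = extRel hρ f r c') : c = c' := by
  have := h.toIsStrictTotalOrder
  have hiff {y : Y} (hy : colourWord τ f y = insertionWord f c) :
      (∃ y₀, c = Sum.inr y₀ ∧ relRank r y ≤ relRank r y₀) ↔
        ∃ y₀, c' = Sum.inr y₀ ∧ relRank r y ≤ relRank r y₀ := by
    rw [← extRel_inl_base_iff hρ c h hy, hrel, extRel_inl_base_iff hρ c' h (hy.trans hword)]
  match c, c' with
  | Sum.inl s, Sum.inl s' => exact congrArg Sum.inl (Subtype.ext hword)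
  | Sum.inl s, Sum.inr y =>
    obtain ⟨_, hy₀, -⟩ := (hiff hword.symm).2 ⟨y, rfl, le_rfl⟩
    exact absurd hy₀ Sum.inl_ne_inr
  | Sum.inr y, Sum.inl s =>
    obtain ⟨_, hy₀, -⟩ := (hiff rfl).1 ⟨y, rfl, le_rfl⟩
    exact absurd hy₀ Sum.inl_ne_inr
  | Sum.inr y, Sum.inr y' =>
    obtain ⟨_, ⟨⟩, hle⟩ := (hiff rfl).1 ⟨y, rfl, le_rfl⟩
    obtain ⟨_, ⟨⟩, hle'⟩ := (hiff hword.symm).2 ⟨y', rfl, le_rfl⟩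
    exact congrArg Sum.inr (Subtype.ext (relRank_injective (hle.antisymm hle')))

theorem ext_injective {f' : Y → A} {r' : Y → Y → Prop} (h : IsAdmissible τ f r)
    (h' : IsAdmissible τ f' r') {c c' : CycleInsertion A τ (minimalPeriod ρ z₀)}
    (hcolour : extColour hρ f c = extColour hρ f' c')
    (hrel : extRel hρ f r c = extRel hρ f' r' c') : f = f' ∧ r = r' ∧ c = c' := by
  have hf : f = f' := congrArg (· ∘ Sum.inl) hcolour
  have hr : r = r' := by rw [← extRel_on_inl hρ c h, hrel, extRel_on_inl hρ c' h']
  subst hf hr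
  have hword (c : CycleInsertion A τ (minimalPeriod ρ z₀)) :
      colourWord (Sum.map τ ρ) (extColour hρ f c) (Sum.inr z₀) = insertionWord f c := by
    rw [colourWord_extColour_inr hρ c h, hρ.orbitMap_base (minimalPeriod_insertionWord hρ c h)]
  exact ⟨rfl, rfl, insertion_eq_of_extRel_eq hρ h (by rw [← hword, hcolour, hword]) hrel⟩

theorem ext_eq_of_insertionWord_eq {F : Y ⊕ Z → A} {R : Y ⊕ Z → Y ⊕ Z → Prop}
    (h : IsAdmissible (Sum.map τ ρ) F R) (hword : insertionWord (F ∘ Sum.inl) c =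
      colourWord ρ (F ∘ Sum.inr) z₀)
    (hbase : ∀ y, colourWord τ (F ∘ Sum.inl) y = colourWord ρ (F ∘ Sum.inr) z₀ →
      (R (Sum.inl y) (Sum.inr z₀) ↔
        ∃ y₀, c = Sum.inr y₀ ∧ relRank (R on Sum.inl) y ≤ relRank (R on Sum.inl) y₀)) :
    extColour hρ (F ∘ Sum.inl) c = F ∧ extRel hρ (F ∘ Sum.inl) (R on Sum.inl) c = R := by
  have hF : extColour hρ (F ∘ Sum.inl) c = F := by
    rw [extColour, hword, hρ.spellColour_colourWord, Sum.elim_comp_inl_inr]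
  have hext := isAdmissible_extRel hρ c h.restrict
  rw [hF] at hext
  refine ⟨hF, hext.rel_eq_of_base hρ h (extRel_on_inl hρ c h.restrict) fun y hy => ?_⟩
  rw [extRel_inl_base_iff hρ c h.restrict (hy.trans hword.symm), hbase y hy]

theorem exists_ext_eq (hτ : ∀ y, y ∈ periodicPts τ) {F : Y ⊕ Z → A} {R : Y ⊕ Z → Y ⊕ Z → Prop}
    (h : IsAdmissible (Sum.map τ ρ) F R) :
    ∃ c : CycleInsertion A τ (minimalPeriod ρ z₀),
      extColour hρ (F ∘ Sum.inl) c = F ∧ extRel hρ (F ∘ Sum.inl) (R on Sum.inl) c = R := by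
  have := h.toIsStrictTotalOrder
  have := h.restrict.toIsStrictTotalOrder
  have hs : minimalPeriod seqShift (colourWord ρ (F ∘ Sum.inr) z₀) = minimalPeriod ρ z₀ := by
    rw [← colourWord_inr τ ρ, h.minimalPeriod_colourWord (mem_periodicPts_inr hρ τ z₀),
      minimalPeriod_apply_of_semiconj (semiconj_inr τ ρ) Sum.inr_injective]
  set below : Set Y := {y | colourWord τ (F ∘ Sum.inl) y = colourWord ρ (F ∘ Sum.inr) z₀ ∧
    R (Sum.inl y) (Sum.inr z₀)}
  rcases below.eq_empty_or_nonempty with hempty | hne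
  · refine ⟨Sum.inl ⟨_, hs⟩, ext_eq_of_insertionWord_eq hρ _ h rfl fun y hy => ?_⟩
    simp only [reduceCtorEq, false_and, exists_false, iff_false]
    exact fun hR => Set.eq_empty_iff_forall_notMem.1 hempty y ⟨hy, hR⟩
  · obtain ⟨y₀, ⟨hy₀, hR₀⟩, hmax⟩ :=
      Set.exists_max_image below (relRank (R on Sum.inl)) (Set.toFinite _) hne
    have hper : minimalPeriod τ y₀ = minimalPeriod ρ z₀ := by
      rw [← h.restrict.minimalPeriod_colourWord (hτ y₀), hy₀, hs]
    refine ⟨Sum.inr ⟨y₀, hper⟩, ext_eq_of_insertionWord_eq hρ _ h hy₀ fun y hy => ?_⟩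
    simp only [Sum.inr.injEq, exists_eq_left']
    refine ⟨fun hR => hmax y ⟨hy, hR⟩, fun hle => ?_⟩
    rcases hle.lt_or_eq with hlt | heq
    · exact trans_of R (relRank_lt_iff (r := R on Sum.inl) |>.1 hlt) hR₀
    · exact relRank_injective heq ▸ hR₀

theorem card_admissiblePair_sumMap (hρ : IsSingleCycle ρ z₀) (hτ : ∀ y, y ∈ periodicPts τ)
    [Finite {s : ℕ → A // minimalPeriod seqShift s = minimalPeriod ρ z₀}] :
    Nat.card (AdmissiblePair A (Sum.map τ ρ)) = Nat.card (AdmissiblePair A τ) *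
      (Nat.card {s : ℕ → A // minimalPeriod seqShift s = minimalPeriod ρ z₀} +
        Nat.card {y : Y // minimalPeriod τ y = minimalPeriod ρ z₀}) := by
  rw [← Nat.card_sum, ← Nat.card_prod]
  let ext (q : AdmissiblePair A τ × CycleInsertion A τ (minimalPeriod ρ z₀)) :
      AdmissiblePair A (Sum.map τ ρ) :=
    ⟨(extColour hρ q.1.1.1 q.2, extRel hρ q.1.1.1 q.1.1.2 q.2), isAdmissible_extRel hρ q.2 q.1.2⟩
  refine (Nat.card_congr (Equiv.ofBijective ext ⟨?_, ?_⟩)).symm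
  · rintro ⟨⟨⟨f, r⟩, h⟩, c⟩ ⟨⟨⟨f', r'⟩, h'⟩, c'⟩ heq
    obtain ⟨hcolour, hrel⟩ := Prod.ext_iff.1 (Subtype.ext_iff.1 heq)
    obtain ⟨rfl, rfl, rfl⟩ := ext_injective hρ h h' hcolour hrel
    rfl
  · rintro ⟨⟨F, R⟩, h⟩
    obtain ⟨c, hF, hR⟩ := exists_ext_eq hρ hτ h
    exact ⟨(⟨(_, _), h.restrict⟩, c), Subtype.ext (Prod.ext hF hR)⟩

end Extension

section PrimitiveWords

theorem apply_mod_of_isPeriodicPt_seqShift {s : ℕ → A} {l : ℕ} (hs : IsPeriodicPt seqShift l s)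
    (j : ℕ) : s (j % l) = s j := by
  have hj := congrFun (hs.iterate_mod_apply j) 0
  simpa only [seqShift_iterate, zero_add] using hj

/-- A sequence of period `l` is the same thing as the word formed by its first `l` letters. -/
def periodicSeqEquiv (A : Type*) (l : ℕ) [NeZero l] :
    {s : ℕ → A // IsPeriodicPt seqShift l s} ≃ (Fin l → A) where
  toFun s i := s.1 i
  invFun g := ⟨fun j => g (Fin.ofNat l j), by
    rw [IsPeriodicPt, IsFixedPt, seqShift_iterate]
    funext j
    congr 1
    ext
    simp⟩
  left_inv s := Subtype.ext <| funext <| apply_mod_of_isPeriodicPt_seqShift s.2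
  right_inv g := by
    funext i
    simp

variable (A) [Finite A] {l : ℕ}

theorem finite_isPeriodicPt_seqShift (hl : l ≠ 0) :
    Finite {s : ℕ → A // IsPeriodicPt seqShift l s} :=
  have : NeZero l := ⟨hl⟩
  Finite.of_equiv _ (periodicSeqEquiv A l).symm

theorem finite_minimalPeriod_seqShift (hl : l ≠ 0) :
    Finite {s : ℕ → A // minimalPeriod seqShift s = l} := by
  have := finite_isPeriodicPt_seqShift A hl
  exact Finite.of_injective (β := {s : ℕ → A // IsPeriodicPt seqShift l s})
    (fun s => ⟨s.1, by simpa only [s.2] using isPeriodicPt_minimalPeriod seqShift s.1⟩)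
    fun s t h => Subtype.ext (Subtype.mk.inj h)

theorem sum_divisors_card_minimalPeriod_seqShift (hl : l ≠ 0) :
    ∑ d ∈ l.divisors, Nat.card {s : ℕ → A // minimalPeriod seqShift s = d} = Nat.card A ^ l := by
  classical
  have : NeZero l := ⟨hl⟩
  have hfin : {s : ℕ → A | IsPeriodicPt seqShift l s}.Finite := finite_isPeriodicPt_seqShift A hl
  have hcard : hfin.toFinset.card = Nat.card A ^ l := by
    rw [← Set.ncard_eq_toFinset_card _ hfin]
    exact (Nat.card_congr (periodicSeqEquiv A l)).trans (by rw [Nat.card_fun, Nat.card_fin])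
  rw [← hcard, Finset.card_eq_sum_card_fiberwise (f := minimalPeriod seqShift) (t := l.divisors)]
  · refine Finset.sum_congr rfl fun d hd => ?_
    rw [← Nat.card_eq_finsetCard]
    refine Nat.card_congr (Equiv.subtypeEquivRight fun s => ?_)
    simp only [Finset.mem_filter, Set.Finite.mem_toFinset, Set.mem_ofPred_eq, iff_and_self]
    rintro rfl
    exact (isPeriodicPt_minimalPeriod seqShift s).trans_dvd (Nat.dvd_of_mem_divisors hd)
  · intro s hs
    have hs : IsPeriodicPt seqShift l s := by simpa using hs
    simpa using ⟨hs.minimalPeriod_dvd, hl⟩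

/-- The polynomial `∑_{d ∣ l} μ(d) X^{l/d}`, whose value at `a` is the number of primitive words of
length `l` over `a` letters. -/
noncomputable def primPoly (l : ℕ) : ℂ[X] :=
  ∑ q ∈ l.divisorsAntidiagonal, C (ArithmeticFunction.moebius q.1 : ℂ) * Polynomial.X ^ q.2

theorem eval_primPoly_natCard (hl : l ≠ 0) :
    (primPoly l).eval (Nat.card A : ℂ) =
      Nat.card {s : ℕ → A // minimalPeriod seqShift s = l} := by
  have hinversion := (ArithmeticFunction.sum_eq_iff_sum_mul_moebius_eq (R := ℂ)
    (f := fun d => (Nat.card {s : ℕ → A // minimalPeriod seqShift s = d} : ℂ))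
    (g := fun d => (Nat.card A : ℂ) ^ d)).1 (fun d hd => by
      rw [← Nat.cast_pow, ← sum_divisors_card_minimalPeriod_seqShift A hd.ne', Nat.cast_sum])
    l (Nat.pos_of_ne_zero hl)
  rw [← hinversion, primPoly, eval_finsetSum]
  simp

@[simp]
theorem primPoly_one : primPoly 1 = Polynomial.X := by simp [primPoly]

end PrimitiveWords

section NecklacePoly

/-- The polynomial whose value at `a` is the number of multisets of primitive necklaces over `a`
letters with lengths `s`, multiplied by the order of the centralizer of a permutation with cycle
lengths `s`. -/
noncomputable def necklacePoly (s : Multiset ℕ) : ℂ[X] :=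
  ∏ l ∈ s.toFinset, ∏ j ∈ Finset.range (s.count l), (primPoly l + C ((l * j : ℕ) : ℂ))

theorem necklacePoly_eq_prod_of_subset {s : Multiset ℕ} {t : Finset ℕ} (h : s.toFinset ⊆ t) :
    necklacePoly s =
      ∏ l ∈ t, ∏ j ∈ Finset.range (s.count l), (primPoly l + C ((l * j : ℕ) : ℂ)) := by
  rw [necklacePoly]
  refine Finset.prod_subset h fun l _ hl => ?_
  rw [Multiset.count_eq_zero_of_notMem (by simpa using hl), Finset.prod_range_zero]

theorem necklacePoly_zero : necklacePoly 0 = 1 := by simp [necklacePoly]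

theorem necklacePoly_cons (l : ℕ) (s : Multiset ℕ) :
    necklacePoly (l ::ₘ s) = necklacePoly s * (primPoly l + C ((l * s.count l : ℕ) : ℂ)) := by
  have hmem : l ∈ (l ::ₘ s).toFinset := by simp
  rw [necklacePoly, necklacePoly_eq_prod_of_subset (t := (l ::ₘ s).toFinset) (by simp),
    ← Finset.mul_prod_erase _ _ hmem, ← Finset.mul_prod_erase _ _ hmem, Multiset.count_cons_self,
    Finset.prod_range_succ, mul_right_comm]
  congr 2
  refine Finset.prod_congr rfl fun k hk => ?_
  rw [Multiset.count_cons_of_ne (Finset.ne_of_mem_erase hk)]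

end NecklacePoly

section CycleModel

theorem sumCongr_one_right_eq_extendDomain
    [DecidablePred (· ∈ Set.range (Sum.inl : Y → Y ⊕ Z))] (σ : Equiv.Perm Y) :
    Equiv.Perm.sumCongr σ (1 : Equiv.Perm Z) =
      σ.extendDomain (Equiv.ofInjective (Sum.inl : Y → Y ⊕ Z) Sum.inl_injective) := by
  ext (y | z)
  · simpa using (Equiv.Perm.extendDomain_apply_image σ
      (Equiv.ofInjective (Sum.inl : Y → Y ⊕ Z) Sum.inl_injective) y).symm
  · rw [Equiv.Perm.extendDomain_apply_not_subtype _ _ (by simp)]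
    rfl

theorem sumCongr_one_left_eq_extendDomain
    [DecidablePred (· ∈ Set.range (Sum.inr : Z → Y ⊕ Z))] (ρ : Equiv.Perm Z) :
    Equiv.Perm.sumCongr (1 : Equiv.Perm Y) ρ =
      ρ.extendDomain (Equiv.ofInjective (Sum.inr : Z → Y ⊕ Z) Sum.inr_injective) := by
  ext (y | z)
  · rw [Equiv.Perm.extendDomain_apply_not_subtype _ _ (by simp)]
    rfl
  · simpa using (Equiv.Perm.extendDomain_apply_image ρ
      (Equiv.ofInjective (Sum.inr : Z → Y ⊕ Z) Sum.inr_injective) z).symm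

theorem permCongr_eq_extendDomain (e : X ≃ Y) (τ : Equiv.Perm X) :
    e.permCongr τ = τ.extendDomain (p := fun _ : Y => True)
      (e.trans (Equiv.subtypeUnivEquiv fun _ => trivial).symm) := by
  ext y
  have h := Equiv.Perm.extendDomain_apply_image τ (p := fun _ : Y => True)
    (e.trans (Equiv.subtypeUnivEquiv fun _ => trivial).symm) (e.symm y)
  simp only [Equiv.trans_apply, Equiv.subtypeUnivEquiv, Equiv.coe_fn_symm_mk,
    Equiv.apply_symm_apply] at h
  exact h.symm

variable [Fintype X] [DecidableEq X] [Fintype Y] [DecidableEq Y] [Fintype Z] [DecidableEq Z]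

theorem cycleType_sumCongr (σ : Equiv.Perm Y) (ρ : Equiv.Perm Z) :
    (Equiv.Perm.sumCongr σ ρ).cycleType = σ.cycleType + ρ.cycleType := by
  have hmul : Equiv.Perm.sumCongr σ ρ = Equiv.Perm.sumCongr σ 1 * Equiv.Perm.sumCongr 1 ρ := by
    simp [Equiv.Perm.sumCongr_mul]
  have hdisj : (Equiv.Perm.sumCongr σ (1 : Equiv.Perm Z)).Disjoint
      (Equiv.Perm.sumCongr (1 : Equiv.Perm Y) ρ) := by
    rintro (y | z)
    · exact Or.inr rfl
    · exact Or.inl rfl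
  rw [hmul, hdisj.cycleType_mul, sumCongr_one_right_eq_extendDomain,
    sumCongr_one_left_eq_extendDomain, Equiv.Perm.cycleType_extendDomain,
    Equiv.Perm.cycleType_extendDomain]

theorem parts_partition_sumCongr (σ : Equiv.Perm Y) (ρ : Equiv.Perm Z) :
    (Equiv.Perm.partition (Equiv.Perm.sumCongr σ ρ)).parts =
      σ.partition.parts + ρ.partition.parts := by
  have hσ := σ.support.card_le_univ
  have hρ := ρ.support.card_le_univ
  simp only [Equiv.Perm.parts_partition, ← Equiv.Perm.sum_cycleType, cycleType_sumCongr,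
    Multiset.sum_add, Fintype.card_sum]
  rw [Equiv.Perm.sum_cycleType, Equiv.Perm.sum_cycleType, ← tsub_add_tsub_comm hσ hρ,
    Multiset.replicate_add, add_add_add_comm]

theorem parts_partition_finRotate {l : ℕ} (hl : l ≠ 0) :
    (finRotate l).partition.parts = {l} := by
  rw [Equiv.Perm.parts_partition, Fintype.card_fin, ← Equiv.Perm.sum_cycleType]
  obtain rfl | h : l = 1 ∨ 2 ≤ l := by omega
  · simp [Subsingleton.elim (finRotate 1) 1]
  · simp [cycleType_finRotate_of_le h]

theorem parts_partition_permCongr (e : X ≃ Y) (τ : Equiv.Perm X) :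
    (e.permCongr τ).partition.parts = τ.partition.parts := by
  have hcycle : (e.permCongr τ).cycleType = τ.cycleType := by
    rw [permCongr_eq_extendDomain, Equiv.Perm.cycleType_extendDomain]
  rw [Equiv.Perm.parts_partition, Equiv.Perm.parts_partition, ← Equiv.Perm.sum_cycleType, hcycle,
    Equiv.Perm.sum_cycleType, Fintype.card_congr e]

theorem exists_equiv_semiconj_of_parts_eq {σ : Equiv.Perm X} {τ : Equiv.Perm Y}
    (h : σ.partition.parts = τ.partition.parts) : ∃ e : X ≃ Y, Semiconj e σ τ := by
  have hcard : Fintype.card X = Fintype.card Y := by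
    rw [← σ.partition.parts_sum, h, τ.partition.parts_sum]
  have e := Fintype.equivOfCardEq hcard
  have hconj : IsConj (e.permCongr σ) τ :=
    Equiv.Perm.partition_eq_of_isConj.2 <|
      Nat.Partition.ext ((parts_partition_permCongr e σ).trans h)
  obtain ⟨g, hg⟩ := isConj_iff.1 hconj
  refine ⟨e.trans g, fun x => ?_⟩
  simp [← hg]

theorem exists_semiconj_sumMap_finRotate {τ : Equiv.Perm X} {l : ℕ} {s : Multiset ℕ}
    (hτ : τ.partition.parts = l ::ₘ s) :
    ∃ (σ : Equiv.Perm (Fin s.sum)) (e : Fin s.sum ⊕ Fin l ≃ X),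
      σ.partition.parts = s ∧ Semiconj e (Sum.map σ (finRotate l)) τ := by
  have hpos : ∀ {i}, i ∈ l ::ₘ s → 0 < i := fun hi => τ.partition.parts_pos (hτ ▸ hi)
  obtain ⟨σ, hσ⟩ :=
    cycleClass_nonempty ⟨s, fun hi => hpos (Multiset.mem_cons_of_mem hi), rfl⟩
  have hσ : σ.partition.parts = s := hσ
  obtain ⟨e, he⟩ := exists_equiv_semiconj_of_parts_eq (τ := τ)
    (σ := Equiv.Perm.sumCongr σ (finRotate l)) (by
      rw [parts_partition_sumCongr, hσ,
        parts_partition_finRotate (hpos (Multiset.mem_cons_self l s)).ne', hτ, add_comm,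
        Multiset.singleton_add])
  exact ⟨σ, e, hσ, he⟩

end CycleModel

section SingleCycle

variable {l : ℕ} [NeZero l]

theorem iterate_finRotate_zero (j : ℕ) : (finRotate l)^[j] 0 = Fin.ofNat l j := by
  induction j with
  | zero => simp
  | succ j ih =>
    rw [iterate_succ_apply', ih, finRotate_apply]
    ext
    simp [Fin.val_add]

theorem iterate_finRotate_zero_val (i : Fin l) : (finRotate l)^[(i : ℕ)] 0 = i := by
  rw [iterate_finRotate_zero]
  ext
  simp

theorem minimalPeriod_finRotate (i : Fin l) : minimalPeriod (finRotate l) i = l := by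
  have hzero : minimalPeriod (finRotate l) 0 = l := by
    refine Nat.dvd_antisymm (IsPeriodicPt.minimalPeriod_dvd ?_) ?_
    · rw [IsPeriodicPt, IsFixedPt, iterate_finRotate_zero]
      ext
      simp
    · have h := iterate_minimalPeriod (f := finRotate l) (x := 0)
      rw [iterate_finRotate_zero, Fin.ext_iff] at h
      exact Nat.dvd_of_mod_eq_zero (by simpa using h)
  rw [← iterate_finRotate_zero_val i,
    minimalPeriod_apply_iterate ((finRotate l).injective.mem_periodicPts 0), hzero]

theorem isSingleCycle_finRotate : IsSingleCycle (finRotate l) (0 : Fin l) where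
  mem_periodicPts := (finRotate l).injective.mem_periodicPts 0
  exists_iterate_eq i := ⟨i, iterate_finRotate_zero_val i⟩

end SingleCycle

section CountAdmissible

theorem card_minimalPeriod_eq_of_semiconj {f : X → X} {g : Y → Y} (e : X ≃ Y)
    (he : Semiconj e f g) (k : ℕ) :
    Nat.card {x // minimalPeriod f x = k} = Nat.card {y // minimalPeriod g y = k} :=
  Nat.card_congr <| e.subtypeEquiv fun x => by
    rw [minimalPeriod_apply_of_semiconj he e.injective]

theorem card_minimalPeriod_sumMap_finRotate [Finite Y] (σ : Y → Y) {l : ℕ} [NeZero l] (k : ℕ) :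
    Nat.card {x // minimalPeriod (Sum.map σ (finRotate l)) x = k} =
      Nat.card {y // minimalPeriod σ y = k} + if k = l then l else 0 := by
  have e : {x // minimalPeriod (Sum.map σ (finRotate l)) x = k} ≃
      {y // minimalPeriod σ y = k} ⊕ {_i : Fin l // k = l} :=
    Equiv.subtypeSum.trans <| Equiv.sumCongr
      (Equiv.subtypeEquivRight fun y => by
        rw [minimalPeriod_apply_of_semiconj (semiconj_inl σ _) Sum.inl_injective])
      (Equiv.subtypeEquivRight fun i => by
        rw [minimalPeriod_apply_of_semiconj (semiconj_inr σ _) Sum.inr_injective,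
          minimalPeriod_finRotate, eq_comm])
  rw [Nat.card_congr e, Nat.card_sum]
  split_ifs with hk <;> simp [hk]

theorem card_minimalPeriod_perm {X : Type} [Fintype X] [DecidableEq X] (τ : Equiv.Perm X) (k : ℕ) :
    Nat.card {x // minimalPeriod τ x = k} = k * τ.partition.parts.count k := by
  induction hs : τ.partition.parts using Multiset.induction generalizing X with
  | empty =>
    have : IsEmpty X := Fintype.card_eq_zero_iff.1 (by rw [← τ.partition.parts_sum, hs]; rfl)
    simp
  | cons l s ih =>
    have : NeZero l := ⟨(τ.partition.parts_pos (hs ▸ Multiset.mem_cons_self l s)).ne'⟩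
    obtain ⟨σ, e, hσ, he⟩ := exists_semiconj_sumMap_finRotate hs
    rw [← card_minimalPeriod_eq_of_semiconj e he, card_minimalPeriod_sumMap_finRotate, ih σ hσ,
      Multiset.count_cons, mul_add]
    split_ifs with hk <;> simp [hk]

variable [LinearOrder A]

theorem card_admissiblePair_of_semiconj {σ : X → X} {τ : Y → Y} (e : X ≃ Y)
    (he : Semiconj e σ τ) :
    Nat.card (AdmissiblePair A τ) = Nat.card (AdmissiblePair A σ) := by
  have he' : Semiconj e.symm τ σ := fun y => by rw [e.symm_apply_eq, he.eq, e.apply_symm_apply]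
  refine Nat.card_congr
    { toFun q := ⟨(q.1.1 ∘ e, q.1.2 on e), q.2.comp_semiconj he e.injective⟩
      invFun q := ⟨(q.1.1 ∘ e.symm, q.1.2 on e.symm), q.2.comp_semiconj he' e.symm.injective⟩
      left_inv q := Subtype.ext (Prod.ext ?_ ?_)
      right_inv q := Subtype.ext (Prod.ext ?_ ?_) }
  all_goals
    funext
    simp [onFun]

theorem card_admissiblePair_of_isEmpty [IsEmpty X] (τ : X → X) :
    Nat.card (AdmissiblePair A τ) = 1 := by
  have hadm : IsAdmissible τ (isEmptyElim : X → A) (isEmptyElim : X → X → Prop) :=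
    { trichotomous x := isEmptyElim x
      irrefl x := isEmptyElim x
      trans x := isEmptyElim x
      mono {x} := isEmptyElim x
      step {x} := isEmptyElim x }
  exact Nat.card_eq_one_iff_unique.2
    ⟨⟨fun _ _ => Subtype.ext (Subsingleton.elim _ _)⟩, ⟨⟨(_, _), hadm⟩⟩⟩

theorem card_admissiblePair_eq_eval_necklacePoly [Finite A] {X : Type} [Fintype X] [DecidableEq X]
    (τ : Equiv.Perm X) :
    (Nat.card (AdmissiblePair A τ) : ℂ) =
      (necklacePoly τ.partition.parts).eval (Nat.card A : ℂ) := by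
  induction hs : τ.partition.parts using Multiset.induction generalizing X with
  | empty =>
    have : IsEmpty X := Fintype.card_eq_zero_iff.1 (by rw [← τ.partition.parts_sum, hs]; rfl)
    rw [card_admissiblePair_of_isEmpty, necklacePoly_zero, eval_one, Nat.cast_one]
  | cons l s ih =>
    have hl : l ≠ 0 := (τ.partition.parts_pos (hs ▸ Multiset.mem_cons_self l s)).ne'
    have : NeZero l := ⟨hl⟩
    obtain ⟨σ, e, hσ, he⟩ := exists_semiconj_sumMap_finRotate hs
    have hperiod := minimalPeriod_finRotate (0 : Fin l)
    have := finite_minimalPeriod_seqShift A (hperiod.symm ▸ hl)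
    rw [card_admissiblePair_of_semiconj e he,
      card_admissiblePair_sumMap isSingleCycle_finRotate σ.injective.mem_periodicPts, hperiod,
      card_minimalPeriod_perm, hσ, necklacePoly_cons, eval_mul, eval_add, eval_C,
      eval_primPoly_natCard A hl, ← ih σ hσ, ← Nat.cast_add, ← Nat.cast_mul]

end CountAdmissible

section Sorting

theorem relRank_lt_card [Finite Y] (r : Y → Y → Prop) [Std.Irrefl r] (y : Y) :
    relRank r y < Nat.card Y := by
  rw [relRank, ← Set.ncard_univ]
  exact Set.ncard_lt_ncard ⟨Set.subset_univ _, fun hs => irrefl_of r y (hs (Set.mem_univ y))⟩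
    (Set.toFinite _)

theorem exists_equiv_fin_lt_iff [Fintype Y] {n : ℕ} (hY : Fintype.card Y = n)
    (r : Y → Y → Prop) [IsStrictTotalOrder Y r] : ∃ σ : Y ≃ Fin n, ∀ x y, σ x < σ y ↔ r x y := by
  have hlt (y : Y) : relRank r y < n := by
    simpa only [Nat.card_eq_fintype_card, hY] using relRank_lt_card r y
  have hbij : Bijective fun y => (⟨relRank r y, hlt y⟩ : Fin n) :=
    (Fintype.bijective_iff_injective_and_card _).2
      ⟨fun _ _ hxy => relRank_injective (Fin.ext_iff.1 hxy), by simpa using hY⟩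
  exact ⟨Equiv.ofBijective _ hbij, fun _ _ => relRank_lt_iff⟩

theorem equiv_fin_eq_of_lt_iff {n : ℕ} {σ σ' : Y ≃ Fin n}
    (h : ∀ x y, σ x < σ y ↔ σ' x < σ' y) : σ = σ' := by
  let e : Fin n ≃o Fin n := ⟨σ.symm.trans σ', fun {i j} => by
    rw [← not_lt, ← not_lt, not_iff_not]
    simp [← h]⟩
  ext x
  have he : e (σ x) = σ x := by rw [Subsingleton.elim e (OrderIso.refl _), OrderIso.refl_apply]
  have he' : e (σ x) = σ' x := congrArg σ' (σ.symm_apply_apply x)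
  rw [← he, he']

variable [LinearOrder A] {n : ℕ}

/-- A word `c` is compatible with `π` if it increases weakly, and strictly at the descents
of `π`. -/
def IsCompatibleWord (π : Equiv.Perm (Fin n)) (c : Fin n → A) : Prop :=
  StrictMono fun i => toLex (c i, π i)

theorem isCompatibleWord_iff {π : Equiv.Perm (Fin n)} {c : Fin n → A} :
    IsCompatibleWord π c ↔ ∀ i j, i < j → c i < c j ∨ c i = c j ∧ π i < π j := by
  simp only [IsCompatibleWord, StrictMono, Prod.Lex.toLex_lt_toLex]

variable {τ : Equiv.Perm X} {σ : X ≃ Fin n}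

theorem IsCompatibleWord.isAdmissible {c : Fin n → A} (hc : IsCompatibleWord (σ.permCongr τ) c) :
    IsAdmissible τ (c ∘ σ) fun x y => σ x < σ y where
  irrefl _ := lt_irrefl _
  trans _ _ _ := lt_trans
  trichotomous x y hxy hyx := σ.injective (le_antisymm (not_lt.1 hyx) (not_lt.1 hxy))
  mono hxy := (isCompatibleWord_iff.1 hc _ _ hxy).elim le_of_lt fun h => h.1.le
  step hxy heq := by
    simpa using ((isCompatibleWord_iff.1 hc _ _ hxy).resolve_left heq.not_lt).2

theorem IsAdmissible.isCompatibleWord {f : X → A} {r : X → X → Prop} (h : IsAdmissible τ f r)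
    (hσ : ∀ x y, σ x < σ y ↔ r x y) : IsCompatibleWord (σ.permCongr τ) (f ∘ σ.symm) := by
  refine isCompatibleWord_iff.2 fun i j hij => ?_
  have hr : r (σ.symm i) (σ.symm j) := by simpa [← hσ] using hij
  refine (h.mono hr).lt_or_eq.imp_right fun heq => ⟨heq, ?_⟩
  rw [Equiv.permCongr_apply, Equiv.permCongr_apply, hσ]
  exact h.step hr heq

variable (A τ n)

/-- Pulling back the order of `Fin n` and a compatible word along a bijection `X ≃ Fin n`. -/
def sortedPair (q : Σ σ : X ≃ Fin n, {c : Fin n → A // IsCompatibleWord (σ.permCongr τ) c}) :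
    AdmissiblePair A τ :=
  ⟨(q.2.1 ∘ q.1, fun x y => q.1 x < q.1 y), q.2.2.isAdmissible⟩

theorem sortedPair_injective : Injective (sortedPair A n τ) := by
  rintro ⟨σ, c, hc⟩ ⟨σ', c', hc'⟩ heq
  have heq := Subtype.ext_iff.1 heq
  obtain rfl : σ = σ' := equiv_fin_eq_of_lt_iff fun x y =>
    iff_of_eq (congrFun₂ (congrArg Prod.snd heq) x y)
  obtain rfl : c = c' := σ.surjective.injective_comp_right (congrArg Prod.fst heq)
  rfl

variable [Fintype X] {n}

theorem sortedPair_surjective (hX : Fintype.card X = n) : Surjective (sortedPair A n τ) := by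
  rintro ⟨⟨f, r⟩, h⟩
  have := h.toIsStrictTotalOrder
  obtain ⟨σ, hσ⟩ := exists_equiv_fin_lt_iff hX r
  refine ⟨⟨σ, f ∘ σ.symm, h.isCompatibleWord hσ⟩, Subtype.ext (Prod.ext ?_ ?_)⟩
  · funext x
    simp [sortedPair]
  · funext x y
    exact propext (hσ x y)

theorem card_admissiblePair_eq_sum_isCompatibleWord [DecidableEq X] [Finite A]
    (hX : Fintype.card X = n) :
    Nat.card (AdmissiblePair A τ) =
      ∑ σ : X ≃ Fin n, Nat.card {c : Fin n → A // IsCompatibleWord (σ.permCongr τ) c} := by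
  rw [← Nat.card_sigma]
  exact (Nat.card_congr
    (Equiv.ofBijective _ ⟨sortedPair_injective A n τ, sortedPair_surjective A τ hX⟩)).symm

end Sorting

section DescentCount

variable {m a : ℕ} (π : Equiv.Perm (Fin (m + 1)))

/-- The number of non-descents of `π` before the position `i`. Adding it to a compatible word makes
the word strictly increasing. -/
def ascentsBefore (i : Fin (m + 1)) : ℕ :=
  (Finset.univ.filter fun k => k < i ∧ k ∉ descentSet π).card

theorem castSucc_mem_descentSet_iff (i : Fin m) :
    i.castSucc ∈ descentSet π ↔ π i.succ < π i.castSucc := by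
  simp only [descentSet, Finset.mem_filter, Finset.mem_univ, true_and]
  exact ⟨fun ⟨_, h⟩ => h, fun h => ⟨by simp, h⟩⟩

theorem last_notMem_descentSet : Fin.last m ∉ descentSet π := by
  simp [descentSet]

theorem ascentsBefore_zero : ascentsBefore π 0 = 0 := by
  simp [ascentsBefore]

theorem ascentsBefore_succ (i : Fin m) :
    ascentsBefore π i.succ =
      ascentsBefore π i.castSucc + if i.castSucc ∈ descentSet π then 0 else 1 := by
  have hlt (k : Fin (m + 1)) : k < i.succ ↔ k < i.castSucc ∨ k = i.castSucc := by
    simp only [Fin.lt_def, Fin.ext_iff, Fin.val_succ, Fin.val_castSucc, Nat.lt_succ_iff_lt_or_eq]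
  have hdisj : Disjoint (Finset.univ.filter fun k => k < i.castSucc ∧ k ∉ descentSet π)
      (Finset.univ.filter fun k => k = i.castSucc ∧ k ∉ descentSet π) :=
    Finset.disjoint_filter.2 fun k _ hk hk' => hk.1.ne hk'.1
  simp only [ascentsBefore, hlt, or_and_right, Finset.filter_or,
    Finset.card_union_of_disjoint hdisj]
  rw [← Finset.filter_filter (fun k => k = i.castSucc), Finset.filter_eq',
    if_pos (Finset.mem_univ _), Finset.filter_singleton]
  split_ifs <;> simp_all

theorem ascentsBefore_last : ascentsBefore π (Fin.last m) + descentNumber π = m := by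
  have hlast : Fin.last m ∈ (descentSet π)ᶜ := by simpa using last_notMem_descentSet π
  have hasc : (Finset.univ.filter fun k => k < Fin.last m ∧ k ∉ descentSet π) =
      (descentSet π)ᶜ.erase (Fin.last m) := by
    ext k
    simp [Fin.lt_last_iff_ne_last]
  have hcard := Finset.card_compl_add_card (descentSet π)
  rw [Fintype.card_fin, ← Finset.card_erase_add_one hlast] at hcard
  rw [ascentsBefore, hasc, descentNumber]
  omega

theorem descentNumber_le : descentNumber π ≤ m :=
  (Nat.le_add_left _ _).trans_eq (ascentsBefore_last π)

theorem ascentsBefore_mono : Monotone (ascentsBefore π) :=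
  Fin.monotone_iff_le_succ.2 fun i => (Nat.le_add_right _ _).trans_eq (ascentsBefore_succ π i).symm

theorem isCompatibleWord_iff_strictMono {c : Fin (m + 1) → Fin a} :
    IsCompatibleWord π c ↔ StrictMono fun i => (c i : ℕ) + ascentsBefore π i := by
  rw [IsCompatibleWord, Fin.strictMono_iff_lt_succ, Fin.strictMono_iff_lt_succ]
  refine forall_congr' fun i => ?_
  have hne : π i.castSucc ≠ π i.succ := π.injective.ne Fin.castSucc_lt_succ.ne
  rw [Prod.Lex.toLex_lt_toLex, ascentsBefore_succ]
  simp only [castSucc_mem_descentSet_iff, Fin.lt_def, Fin.ext_iff, ne_eq] at hne ⊢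
  split_ifs <;> omega

section StrictMono

variable {N : ℕ} {e : Fin (m + 1) → Fin N}

theorem monotone_sub_ascentsBefore (he : StrictMono e) :
    Monotone fun i => ((e i : ℕ) : ℤ) - ascentsBefore π i := by
  refine Fin.monotone_iff_le_succ.2 fun i => ?_
  have hlt : (e i.castSucc : ℕ) < e i.succ := he Fin.castSucc_lt_succ
  rw [ascentsBefore_succ]
  split_ifs <;> omega

theorem ascentsBefore_le_of_strictMono (he : StrictMono e) (i : Fin (m + 1)) :
    ascentsBefore π i ≤ e i := by
  have h := monotone_sub_ascentsBefore π he (Fin.zero_le i)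
  simp only [ascentsBefore_zero] at h
  omega

theorem sub_ascentsBefore_lt (he : StrictMono e) (hN : N = a + m - descentNumber π)
    (i : Fin (m + 1)) :
    (e i : ℕ) - ascentsBefore π i < a := by
  have hle := monotone_sub_ascentsBefore π he (Fin.le_last i)
  have hlast := ascentsBefore_last π
  have := (e (Fin.last m)).2
  have := ascentsBefore_le_of_strictMono π he i
  simp only at hle
  omega

theorem isCompatibleWord_sub_ascentsBefore (he : StrictMono e)
    (hN : N = a + m - descentNumber π) :
    IsCompatibleWord π fun i =>
      (⟨(e i : ℕ) - ascentsBefore π i, sub_ascentsBefore_lt π he hN i⟩ : Fin a) := by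
  simp only [isCompatibleWord_iff_strictMono,
    Nat.sub_add_cancel (ascentsBefore_le_of_strictMono π he _)]
  exact he

end StrictMono

theorem add_ascentsBefore_lt (c : Fin a) (i : Fin (m + 1)) :
    (c : ℕ) + ascentsBefore π i < a + m - descentNumber π := by
  have hle := ascentsBefore_mono π (Fin.le_last i)
  have hlast := ascentsBefore_last π
  have := c.2
  omega

/-- Adding the number of preceding non-descents turns compatible words into strictly increasing
ones. -/
def compatibleWordEquiv :
    {c : Fin (m + 1) → Fin a // IsCompatibleWord π c} ≃
      {e : Fin (m + 1) → Fin (a + m - descentNumber π) // StrictMono e} where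
  toFun c := ⟨fun i => ⟨(c.1 i : ℕ) + ascentsBefore π i, add_ascentsBefore_lt π (c.1 i) i⟩,
    (isCompatibleWord_iff_strictMono π).1 c.2⟩
  invFun e := ⟨_, isCompatibleWord_sub_ascentsBefore π e.2 rfl⟩
  left_inv c := by
    ext i
    simp
  right_inv e := by
    ext i
    exact Nat.sub_add_cancel (ascentsBefore_le_of_strictMono π e.2 i)

theorem card_strictMono_fin (n N : ℕ) :
    Nat.card {e : Fin n → Fin N // StrictMono e} = N.choose n := by
  have e : {e : Fin n → Fin N // StrictMono e} ≃ (Fin n ↪o Fin N) :=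
    ⟨fun e => OrderEmbedding.ofStrictMono e.1 e.2, fun e => ⟨e, e.strictMono⟩,
      fun _ => rfl, fun _ => by ext; rfl⟩
  rw [Nat.card_congr e, Nat.card_congr Set.powersetCard.ofFinEmbEquiv, Set.powersetCard.card,
    Nat.card_fin]

theorem card_isCompatibleWord :
    Nat.card {c : Fin (m + 1) → Fin a // IsCompatibleWord π c} =
      (a + m - descentNumber π).choose (m + 1) := by
  rw [Nat.card_congr (compatibleWordEquiv π), card_strictMono_fin]

theorem factorial_mul_choose_eq_prod {d : ℕ} (hd : d ≤ m) (a : ℕ) :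
    ((m + 1).factorial : ℂ) * ((a + m - d).choose (m + 1) : ℕ) =
      ∏ k ∈ Finset.range (m + 1), ((a : ℂ) + (k - d)) := by
  rw [← Nat.cast_mul, ← Nat.descFactorial_eq_factorial_mul_choose,
    ← descPochhammer_eval_eq_descFactorial, descPochhammer_eval_eq_prod_range,
    ← Finset.prod_range_reflect]
  refine Finset.prod_congr rfl fun k hk => ?_
  have hk : k ≤ m := Nat.lt_succ_iff.1 (Finset.mem_range.1 hk)
  rw [Nat.cast_sub (by omega), Nat.add_sub_cancel, Nat.cast_sub hk]
  push_cast
  ring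

theorem factorial_mul_card_isCompatibleWord {n : ℕ} (π : Equiv.Perm (Fin n)) (a : ℕ) :
    (n.factorial : ℂ) * Nat.card {c : Fin n → Fin a // IsCompatibleWord π c} =
      ∏ k ∈ Finset.range n, ((a : ℂ) + (k - descentNumber π)) := by
  obtain _ | m := n
  · have : Unique {c : Fin 0 → Fin a // IsCompatibleWord π c} :=
      ⟨⟨⟨finZeroElim, fun i => i.elim0⟩⟩, fun _ => Subtype.ext (Subsingleton.elim _ _)⟩
    simp
  · rw [card_isCompatibleWord, factorial_mul_choose_eq_prod (descentNumber_le π)]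

end DescentCount

end Combinatorics

section ClassAverage

open MeasureTheory ProbabilityTheory Polynomial

theorem integral_uniformOn_coe_finset {Ω E : Type*} [MeasurableSpace Ω] [MeasurableSingletonClass Ω]
    [NormedAddCommGroup E] [NormedSpace ℝ E] [CompleteSpace E] (s : Finset Ω) (f : Ω → E) :
    ∫ x, f x ∂uniformOn (s : Set Ω) = (s.card : ℝ)⁻¹ • ∑ x ∈ s, f x := by
  have hint : IntegrableOn f s Measure.count := by
    rw [← Set.biUnion_of_singleton (s : Set Ω)]
    exact integrableOn_finset_iUnion.2 fun x _ => integrableOn_singleton (hx := by simp)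
  rw [uniformOn, ProbabilityTheory.cond, integral_smul_measure, setIntegral_finset s hint]
  simp [Measure.count_apply_finset]

theorem card_smul_sum_conj {G M : Type*} [Group G] [Fintype G] [AddCommMonoid M] {τ : G}
    {C : Finset G} (hC : ∀ π, π ∈ C ↔ IsConj τ π) (g : G → M) :
    C.card • ∑ ρ : G, g (ρ * τ * ρ⁻¹) = Fintype.card G • ∑ π ∈ C, g π := by
  have hbase : ∀ π ∈ C, ∑ ρ : G, g (ρ * π * ρ⁻¹) = ∑ ρ : G, g (ρ * τ * ρ⁻¹) := fun π hπ => by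
    obtain ⟨κ, rfl⟩ := isConj_iff.1 ((hC π).1 hπ)
    refine Fintype.sum_equiv (Equiv.mulRight κ) _ _ fun ρ => ?_
    simp only [Equiv.coe_mulRight, mul_inv_rev, mul_assoc]
  have hclass (ρ : G) : ∑ π ∈ C, g (ρ * π * ρ⁻¹) = ∑ π ∈ C, g π := by
    refine Finset.sum_equiv (MulAut.conj ρ).toEquiv (fun π => ?_) fun π _ => rfl
    rw [hC, hC]
    exact ⟨fun h => h.trans (isConj_iff.2 ⟨ρ, rfl⟩), fun h => h.trans (isConj_iff.2 ⟨ρ, rfl⟩).symm⟩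
  calc C.card • ∑ ρ : G, g (ρ * τ * ρ⁻¹) = ∑ π ∈ C, ∑ ρ : G, g (ρ * π * ρ⁻¹) := by
        rw [Finset.sum_congr rfl hbase, Finset.sum_const]
    _ = ∑ ρ : G, ∑ π ∈ C, g (ρ * π * ρ⁻¹) := Finset.sum_comm
    _ = Fintype.card G • ∑ π ∈ C, g π := by
        rw [Finset.sum_congr rfl fun ρ _ => hclass ρ, Finset.sum_const, Finset.card_univ]

variable {n : ℕ} {p : n.Partition}

theorem mem_cycleClass_iff_isConj {τ π : Equiv.Perm (Fin n)} (hτ : τ ∈ cycleClass p) :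
    π ∈ cycleClass p ↔ IsConj τ π := by
  have hτ : τ.partition.parts = p.parts := hτ
  rw [cycleClass, Set.mem_ofPred_eq, ← hτ, Equiv.Perm.partition_eq_of_isConj,
    Nat.Partition.ext_iff, eq_comm]

theorem sum_conj_eq_factorial_mul_integral {τ : Equiv.Perm (Fin n)} (hτ : τ ∈ cycleClass p)
    (g : Equiv.Perm (Fin n) → ℂ) :
    ∑ ρ : Equiv.Perm (Fin n), g (ρ * τ * ρ⁻¹) = n.factorial * ∫ π, g π ∂(uniformClass p) := by
  classical
  let C : Finset (Equiv.Perm (Fin n)) := (cycleClass p).toFinset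
  have hC (π : Equiv.Perm (Fin n)) : π ∈ C ↔ IsConj τ π :=
    Set.mem_toFinset.trans (mem_cycleClass_iff_isConj hτ)
  have hcard : (C.card : ℂ) ≠ 0 :=
    Nat.cast_ne_zero.2 (Finset.card_ne_zero_of_mem ((hC τ).2 (IsConj.refl τ)))
  have havg := card_smul_sum_conj hC g
  rw [Fintype.card_perm, Fintype.card_fin, nsmul_eq_mul, nsmul_eq_mul] at havg
  rw [uniformClass, ← (cycleClass p).coe_toFinset, integral_uniformOn_coe_finset,
    Complex.real_smul, Complex.ofReal_inv, Complex.ofReal_natCast, mul_left_comm,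
    eq_inv_mul_iff_mul_eq₀ hcard, havg]

theorem sum_conj_prod_eq_eval_necklacePoly (τ : Equiv.Perm (Fin n)) (z : ℂ) :
    ∑ ρ : Equiv.Perm (Fin n),
        ∏ k ∈ Finset.range n, (z + ((k : ℂ) - descentNumber (ρ * τ * ρ⁻¹))) =
      n.factorial * (necklacePoly τ.partition.parts).eval z := by
  have hpoly : ∑ ρ : Equiv.Perm (Fin n),
        ∏ k ∈ Finset.range n, (X + C ((k : ℂ) - descentNumber (ρ * τ * ρ⁻¹))) =
      C (n.factorial : ℂ) * necklacePoly τ.partition.parts := by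
    refine eq_of_infinite_eval_eq _ _
      ((Set.infinite_range_of_injective (Nat.cast_injective (R := ℂ))).mono ?_)
    rintro _ ⟨a, rfl⟩
    have hcount := card_admissiblePair_eq_eval_necklacePoly (A := Fin a) τ
    rw [card_admissiblePair_eq_sum_isCompatibleWord (Fin a) τ (Fintype.card_fin n),
      Nat.card_fin] at hcount
    simp only [Set.mem_ofPred_eq, eval_mul, eval_C, ← hcount, eval_finsetSum, eval_prod, eval_add,
      eval_X, Nat.cast_sum, Finset.mul_sum, factorial_mul_card_isCompatibleWord]
    rfl
  simpa only [eval_finsetSum, eval_prod, eval_add, eval_X, eval_C, eval_mul] using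
    congrArg (eval z) hpoly

theorem integral_prod_eq_eval_necklacePoly (p : n.Partition) (z : ℂ) :
    ∫ π, ∏ k ∈ Finset.range n, (z + ((k : ℂ) - descentNumber π)) ∂(uniformClass p) =
      (necklacePoly p.parts).eval z := by
  obtain ⟨τ, hτ⟩ := cycleClass_nonempty p
  have hsum := sum_conj_prod_eq_eval_necklacePoly τ z
  rw [sum_conj_eq_factorial_mul_integral hτ fun π =>
    ∏ k ∈ Finset.range n, (z + ((k : ℂ) - descentNumber π)),
    show τ.partition.parts = p.parts from hτ] at hsum
  exact mul_left_cancel₀ (Nat.cast_ne_zero.2 n.factorial_ne_zero) hsum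

end ClassAverage

section NecklaceAsymptotics

open Polynomial MeasureTheory

variable {u : ℂ}

theorem snd_lt_of_mem_divisorsAntidiagonal_erase {l : ℕ} {q : ℕ × ℕ}
    (hq : q ∈ l.divisorsAntidiagonal.erase (1, l)) : q.2 < l := by
  obtain ⟨hne, hq⟩ := Finset.mem_erase.1 hq
  obtain ⟨hmul, hl⟩ := Nat.mem_divisorsAntidiagonal.1 hq
  refine lt_of_le_of_ne (Nat.le_of_dvd (Nat.pos_of_ne_zero hl) ⟨q.1, by rw [← hmul, mul_comm]⟩) ?_
  rintro heq
  exact hne (Prod.ext (Nat.eq_of_mul_eq_mul_right (Nat.pos_of_ne_zero hl) (by lia)) heq)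

theorem eval_primPoly_inv_mul_pow_sub_one {l : ℕ} (hl : l ≠ 0) (hu : u ≠ 0) :
    (primPoly l).eval u⁻¹ * u ^ l - 1 =
      ∑ q ∈ l.divisorsAntidiagonal.erase (1, l),
        (ArithmeticFunction.moebius q.1 : ℂ) * u ^ (l - q.2) := by
  have hterm (q : ℕ × ℕ) (hq : q.2 ≤ l) : u⁻¹ ^ q.2 * u ^ l = u ^ (l - q.2) := by
    rw [pow_sub₀ u hu hq, inv_pow, mul_comm]
  rw [primPoly, eval_finsetSum, ← Finset.add_sum_erase _ _ (show (1, l) ∈ _ by simp [hl]), add_mul,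
    Finset.sum_mul]
  simp only [eval_mul, eval_C, eval_pow, eval_X, ArithmeticFunction.moebius_apply_one, Int.cast_one,
    one_mul, mul_assoc, hterm (1, l) le_rfl, tsub_self, pow_zero, add_sub_cancel_left]
  refine Finset.sum_congr rfl fun q hq => ?_
  rw [hterm q (snd_lt_of_mem_divisorsAntidiagonal_erase hq).le]

theorem norm_eval_primPoly_inv_mul_pow_sub_one_le {l : ℕ} (hl : l ≠ 0) (hu₀ : u ≠ 0)
    (hu : ‖u‖ ≤ 1) : ‖(primPoly l).eval u⁻¹ * u ^ l - 1‖ ≤ l * ‖u‖ := by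
  have hcard : (l.divisorsAntidiagonal.erase (1, l)).card ≤ l := by
    refine Finset.card_erase_le.trans ?_
    rw [← Nat.map_div_right_divisors, Finset.card_map]
    exact Nat.card_divisors_le_self l
  have hterm : ∀ q ∈ l.divisorsAntidiagonal.erase (1, l),
      ‖(ArithmeticFunction.moebius q.1 : ℂ) * u ^ (l - q.2)‖ ≤ ‖u‖ := fun q hq => by
    have hmu : ‖(ArithmeticFunction.moebius q.1 : ℂ)‖ ≤ 1 := by
      rw [Complex.norm_intCast]
      exact_mod_cast ArithmeticFunction.abs_moebius_le_one
    have hexp : l - q.2 ≠ 0 := (Nat.sub_pos_of_lt (snd_lt_of_mem_divisorsAntidiagonal_erase hq)).ne'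
    calc ‖(ArithmeticFunction.moebius q.1 : ℂ) * u ^ (l - q.2)‖
        ≤ 1 * ‖u‖ := by
          rw [norm_mul, norm_pow]
          gcongr
          exact pow_le_of_le_one (norm_nonneg u) hu hexp
      _ = ‖u‖ := one_mul _
  rw [eval_primPoly_inv_mul_pow_sub_one hl hu₀]
  refine (norm_sum_le_of_le _ hterm).trans ?_
  rw [Finset.sum_const, nsmul_eq_mul]
  gcongr

theorem norm_eval_necklaceFactor_sub_one_le {l j N : ℕ} (hl : 2 ≤ l) (hj : j ≤ N) (hu₀ : u ≠ 0)
    (hu : ‖u‖ ≤ 1) :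
    ‖(primPoly l + C ((l * j : ℕ) : ℂ)).eval u⁻¹ * u ^ l - 1‖ ≤ l * (‖u‖ + N * ‖u‖ ^ 2) := by
  have hconst : ‖((l * j : ℕ) : ℂ) * u ^ l‖ ≤ l * (N * ‖u‖ ^ 2) := by
    have hpow : ‖u‖ ^ l ≤ ‖u‖ ^ 2 := pow_le_pow_of_le_one (norm_nonneg u) hu hl
    rw [norm_mul, norm_pow, Complex.norm_natCast, Nat.cast_mul, mul_assoc]
    gcongr
  calc ‖(primPoly l + C ((l * j : ℕ) : ℂ)).eval u⁻¹ * u ^ l - 1‖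
      = ‖((primPoly l).eval u⁻¹ * u ^ l - 1) + ((l * j : ℕ) : ℂ) * u ^ l‖ := by
        rw [eval_add, eval_C]
        ring_nf
    _ ≤ l * ‖u‖ + l * (N * ‖u‖ ^ 2) :=
        norm_add_le_of_le (norm_eval_primPoly_inv_mul_pow_sub_one_le (by lia) hu₀ hu) hconst
    _ = l * (‖u‖ + N * ‖u‖ ^ 2) := by ring

theorem eval_necklacePoly_mul_pow_sum (s : Multiset ℕ) (z u : ℂ) :
    (necklacePoly s).eval z * u ^ s.sum =
      (∏ j ∈ Finset.range (s.count 1), (z + j) * u) *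
        ∏ q ∈ (s.toFinset.erase 1).sigma fun l => Finset.range (s.count l),
          (primPoly q.1 + C ((q.1 * q.2 : ℕ) : ℂ)).eval z * u ^ q.1 := by
  have hsub : s.toFinset ⊆ insert 1 (s.toFinset.erase 1) := Finset.insert_erase_subset 1 _
  have hpow : u ^ s.sum =
      ∏ l ∈ insert 1 (s.toFinset.erase 1), ∏ _j ∈ Finset.range (s.count l), u ^ l := by
    rw [Finset.sum_multiset_count_of_subset s _ hsub, ← Finset.prod_pow_eq_pow_sum]
    simp only [smul_eq_mul, Finset.prod_const, Finset.card_range, pow_mul']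
  rw [necklacePoly_eq_prod_of_subset hsub, hpow, eval_prod, ← Finset.prod_mul_distrib,
    Finset.prod_insert (Finset.notMem_erase 1 _), Finset.prod_sigma]
  simp only [eval_prod, ← Finset.prod_mul_distrib, primPoly_one, eval_add, eval_X, eval_C, one_mul,
    pow_one]

theorem sum_sigma_count_le_sum (s : Multiset ℕ) (a : ℕ) :
    ∑ q ∈ (s.toFinset.erase a).sigma (fun l => Finset.range (s.count l)), q.1 ≤ s.sum := by
  rw [Finset.sum_sigma, Finset.sum_multiset_count]
  simp only [Finset.sum_const, Finset.card_range]
  exact Finset.sum_le_sum_of_subset (Finset.erase_subset a _)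

theorem norm_eval_necklacePoly_mul_pow_sub_prod_le {s : Multiset ℕ} (hs : 0 ∉ s) (hu₀ : u ≠ 0)
    (hu : ‖u‖ ≤ 1) :
    ‖(necklacePoly s).eval u⁻¹ * u ^ s.sum - ∏ j ∈ Finset.range (s.count 1), (1 + j * u)‖ ≤
      ‖∏ j ∈ Finset.range (s.count 1), (1 + j * u)‖ *
        (Real.exp (s.sum * (‖u‖ + s.card * ‖u‖ ^ 2)) - 1) := by
  set T := (s.toFinset.erase 1).sigma fun l => Finset.range (s.count l) with hT
  set err : (_ : ℕ) × ℕ → ℂ := fun q =>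
    (primPoly q.1 + C ((q.1 * q.2 : ℕ) : ℂ)).eval u⁻¹ * u ^ q.1 - 1 with herr
  have herr_le : ∀ q ∈ T, ‖err q‖ ≤ q.1 * (‖u‖ + s.card * ‖u‖ ^ 2) := fun q hq => by
    simp only [hT, Finset.mem_sigma, Finset.mem_erase, Multiset.mem_toFinset,
      Finset.mem_range] at hq
    have hq_ne_zero : q.1 ≠ 0 := fun h => hs (h ▸ hq.1.2)
    exact norm_eval_necklaceFactor_sub_one_le (by lia) (hq.2.le.trans (s.count_le_card q.1)) hu₀ hu
  have hsum_err : ∑ q ∈ T, ‖err q‖ ≤ s.sum * (‖u‖ + s.card * ‖u‖ ^ 2) :=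
    calc ∑ q ∈ T, ‖err q‖ ≤ ((∑ q ∈ T, q.1 : ℕ) : ℝ) * (‖u‖ + s.card * ‖u‖ ^ 2) := by
          rw [Nat.cast_sum, Finset.sum_mul]
          exact Finset.sum_le_sum herr_le
      _ ≤ s.sum * (‖u‖ + s.card * ‖u‖ ^ 2) := by
          gcongr
          exact sum_sigma_count_le_sum s 1
  have hones : ∏ j ∈ Finset.range (s.count 1), (u⁻¹ + j) * u =
      ∏ j ∈ Finset.range (s.count 1), (1 + j * u) :=
    Finset.prod_congr rfl fun j _ => by rw [add_mul, inv_mul_cancel₀ hu₀]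
  have hrest : ‖∏ q ∈ T, (1 + err q) - 1‖ ≤ Real.exp (s.sum * (‖u‖ + s.card * ‖u‖ ^ 2)) - 1 :=
    (Finset.norm_prod_one_add_sub_one_le T err).trans (by gcongr)
  simp only [herr, add_sub_cancel] at hrest
  rw [eval_necklacePoly_mul_pow_sum, hones, ← mul_sub_one, norm_mul]
  gcongr

variable {n : ℕ}

theorem card_parts_le (p : n.Partition) : p.parts.card ≤ n := by
  have h := Multiset.card_nsmul_le_sum (s := p.parts) (a := 1) fun _ => p.parts_pos
  rwa [smul_eq_mul, mul_one, p.parts_sum] at h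

theorem norm_integral_prod_sub_prod_le (p : n.Partition) (hu : ‖u‖ ≤ 1) :
    ‖∫ π, ∏ k ∈ Finset.range n, (1 + ((k : ℂ) - descentNumber π) * u) ∂(uniformClass p) -
        ∏ j ∈ Finset.range (numFixed p), (1 + j * u)‖ ≤
      ‖∏ j ∈ Finset.range (numFixed p), (1 + j * u)‖ *
        (Real.exp (n * (‖u‖ + n * ‖u‖ ^ 2)) - 1) := by
  rcases eq_or_ne u 0 with rfl | hu₀
  · simp
  have hfactor (c : ℂ) : ∏ k ∈ Finset.range n, (1 + (k - c) * u) =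
      (∏ k ∈ Finset.range n, (u⁻¹ + (k - c))) * u ^ n := by
    have hterm (k : ℕ) : 1 + (k - c) * u = (u⁻¹ + (k - c)) * u := by
      rw [add_mul, inv_mul_cancel₀ hu₀]
    simp only [hterm, Finset.prod_mul_distrib, Finset.prod_const, Finset.card_range]
  simp only [hfactor, integral_mul_const, integral_prod_eq_eval_necklacePoly]
  have hcard : (p.parts.card : ℝ) ≤ n := mod_cast card_parts_le p
  have hbound := norm_eval_necklacePoly_mul_pow_sub_prod_le
    (s := p.parts) (fun h => (p.parts_pos h).ne rfl) hu₀ hu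
  rw [p.parts_sum] at hbound
  refine hbound.trans ?_
  rw [numFixed]
  gcongr

end NecklaceAsymptotics

section Expansion

open Complex

theorem norm_log_one_add_sub_le {w : ℂ} (hw : ‖w‖ ≤ 1 / 2) :
    ‖log (1 + w) - (w - w ^ 2 / 2)‖ ≤ ‖w‖ ^ 3 := by
  have htaylor : logTaylor 3 w = w - w ^ 2 / 2 := by
    norm_num [logTaylor_succ, logTaylor_zero]
    ring
  have hinv : (1 - ‖w‖)⁻¹ ≤ 3 := by
    rw [inv_le_comm₀ (by linarith) (by norm_num)]
    linarith
  calc ‖log (1 + w) - (w - w ^ 2 / 2)‖ ≤ ‖w‖ ^ 3 * (1 - ‖w‖)⁻¹ / 3 := by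
        rw [← htaylor]
        exact (norm_log_sub_logTaylor_le 2 (by linarith)).trans_eq (by norm_num)
    _ ≤ ‖w‖ ^ 3 * 3 / 3 := by gcongr
    _ = ‖w‖ ^ 3 := by ring

variable {ι : Type*} {s : Finset ι} {x : ι → ℂ}

/-- The total error made by replacing each `log (1 + x i)`, `i ∈ s`, by its second-order Taylor
polynomial. -/
noncomputable def logRemainder (s : Finset ι) (x : ι → ℂ) : ℂ :=
  ∑ i ∈ s, (log (1 + x i) - (x i - x i ^ 2 / 2))

theorem norm_logRemainder_le {B : ℝ} (hB : B ≤ 1 / 2) (hx : ∀ i ∈ s, ‖x i‖ ≤ B) :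
    ‖logRemainder s x‖ ≤ s.card * B ^ 3 := by
  rw [← nsmul_eq_mul, ← Finset.sum_const]
  refine norm_sum_le_of_le s fun i hi => (norm_log_one_add_sub_le ((hx i hi).trans hB)).trans ?_
  gcongr
  exact hx i hi

theorem prod_one_add_eq_exp (hx : ∀ i ∈ s, 1 + x i ≠ 0) :
    ∏ i ∈ s, (1 + x i) = exp (∑ i ∈ s, x i - (∑ i ∈ s, x i ^ 2) / 2 + logRemainder s x) := by
  rw [logRemainder, Finset.sum_sub_distrib, Finset.sum_sub_distrib, Finset.sum_div,
    add_sub_cancel, exp_sum]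
  exact Finset.prod_congr rfl fun i hi => (exp_log (hx i hi)).symm

theorem sum_range_cast_sub (N : ℕ) (d : ℝ) :
    ∑ k ∈ Finset.range N, ((k : ℝ) - d) = N * ((N - 1) / 2 - d) := by
  induction N with
  | zero => simp
  | succ N ih =>
    rw [Finset.sum_range_succ, ih]
    push_cast
    ring

theorem sum_range_cast_sub_sq (N : ℕ) (d : ℝ) :
    ∑ k ∈ Finset.range N, ((k : ℝ) - d) ^ 2 =
      N * ((N - 1) / 2 - d) ^ 2 + N * (N ^ 2 - 1) / 12 := by
  induction N with
  | zero => simp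
  | succ N ih =>
    rw [Finset.sum_range_succ, ih]
    push_cast
    ring

theorem prod_range_one_add_mul_I (N d : ℕ) (t : ℝ) :
    ∏ k ∈ Finset.range N, (1 + ((k : ℂ) - d) * (t * I)) =
      exp ((t * (N * ((N - 1) / 2 - d)) : ℝ) * I +
        (t ^ 2 / 2 * (N * ((N - 1) / 2 - d) ^ 2 + N * (N ^ 2 - 1) / 12) : ℝ) +
          logRemainder (Finset.range N) fun k => ((k : ℂ) - d) * (t * I)) := by
  have hne (k : ℕ) : 1 + ((k : ℂ) - d) * (t * I) ≠ 0 := fun h => by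
    simpa using congrArg re h
  rw [prod_one_add_eq_exp fun k _ => hne k, ← sum_range_cast_sub, ← sum_range_cast_sub_sq]
  simp only [mul_pow, I_sq, ← Finset.sum_mul]
  congr 2
  push_cast
  ring

end Expansion

section ScaledExpansion

open MeasureTheory Complex

variable {n : ℕ} {b s : ℝ}

/-- The number of ascents of `π`, centred at its mean `(n - 1) / 2` over the whole symmetric
group. -/
noncomputable def centredAscents (π : Equiv.Perm (Fin n)) : ℝ :=
  ((n : ℝ) - 1) / 2 - descentNumber π

/-- The centring of `centredAscents` over the class `C_p`: the first-order term
`m₁ (m₁ - 1) / (2 n)` contributed by the fixed points. -/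
noncomputable def fixedPointShift (p : n.Partition) : ℝ :=
  (numFixed p : ℝ) * (numFixed p - 1) / (2 * n)

/-- The coefficient of the quadratic term in the expansion of the generating function at the point
`(s / (n b)) I`. -/
noncomputable def quadCoeff (s b : ℝ) (n : ℕ) : ℝ :=
  s ^ 2 * (n / b ^ 2) / 2

theorem quadCoeff_nonneg (s b : ℝ) (n : ℕ) : 0 ≤ quadCoeff s b n := by
  unfold quadCoeff
  positivity

/-- A bound, uniform over the permutations, for the terms of the expansion of the generating
function at `(s / (n b)) I` that vanish in the limit. -/
noncomputable def expansionError (s b : ℝ) (n : ℕ) : ℝ :=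
  quadCoeff s b n / (12 * n ^ 2) + n * (|s| / b) ^ 3

theorem abs_centredAscents_div_le (hn : n ≠ 0) (π : Equiv.Perm (Fin n)) :
    |centredAscents π / n| ≤ 1 / 2 := by
  obtain ⟨m, rfl⟩ := Nat.exists_eq_succ_of_ne_zero hn
  have hle : (descentNumber π : ℝ) ≤ m := mod_cast descentNumber_le π
  rw [abs_div, Nat.abs_cast, div_le_iff₀ (by positivity), centredAscents, abs_le]
  push_cast
  constructor <;> linarith [Nat.cast_nonneg (α := ℝ) (descentNumber π)]

theorem numFixed_le (p : n.Partition) : numFixed p ≤ n :=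
  (Multiset.count_le_card _ _).trans (card_parts_le p)

theorem norm_logRemainder_range_le {N d : ℕ} (hN : N ≤ n) (hd : d ≤ n) (hn : n ≠ 0) (hb : 0 < b)
    (hsb : |s| / b ≤ 1 / 2) :
    ‖logRemainder (Finset.range N) fun k => ((k : ℂ) - d) * ((s / (n * b) : ℝ) * I)‖ ≤
      n * (|s| / b) ^ 3 := by
  have hterm : ∀ k ∈ Finset.range N, ‖((k : ℂ) - d) * ((s / (n * b) : ℝ) * I)‖ ≤ |s| / b :=
    fun k hk => by
      have hkd : |(k : ℝ) - d| ≤ n := by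
        have hk : (k : ℝ) ≤ n := mod_cast (Finset.mem_range.1 hk).le.trans hN
        have hd : (d : ℝ) ≤ n := mod_cast hd
        rw [abs_le]
        constructor <;> linarith [Nat.cast_nonneg (α := ℝ) k, Nat.cast_nonneg (α := ℝ) d]
      calc ‖((k : ℂ) - d) * ((s / (n * b) : ℝ) * I)‖ = |(k : ℝ) - d| * |s / (n * b)| := by
            rw [norm_mul, norm_mul, norm_I, mul_one, norm_real, Real.norm_eq_abs,
              ← Real.norm_eq_abs (k - d), ← norm_real]
            push_cast
            rfl
        _ ≤ n * |s / (n * b)| := by gcongr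
        _ = |s| / b := by
            rw [abs_div, abs_mul, Nat.abs_cast, abs_of_pos hb]
            field_simp
  refine (norm_logRemainder_le hsb hterm).trans ?_
  rw [Finset.card_range]
  gcongr

theorem prod_descents_eq_exp (hn : n ≠ 0) (hb : b ≠ 0) (π : Equiv.Perm (Fin n)) :
    ∏ k ∈ Finset.range n, (1 + ((k : ℂ) - descentNumber π) * ((s / (n * b) : ℝ) * I)) =
      exp ((s * (centredAscents π / b) : ℝ) * I +
        (quadCoeff s b n * ((centredAscents π / n) ^ 2 + 1 / 12 - 1 / (12 * n ^ 2)) : ℝ) +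
        logRemainder (Finset.range n) fun k =>
          ((k : ℂ) - descentNumber π) * ((s / (n * b) : ℝ) * I)) := by
  rw [prod_range_one_add_mul_I, centredAscents, quadCoeff]
  congr 3
  · congr 2
    field_simp
  · congr 1
    field_simp
    ring

theorem prod_fixedPoints_eq_exp (p : n.Partition) (hn : n ≠ 0) (hb : b ≠ 0) :
    ∏ j ∈ Finset.range (numFixed p), (1 + j * ((s / (n * b) : ℝ) * I)) =
      exp ((s * (fixedPointShift p / b) : ℝ) * I +
        (quadCoeff s b n * (((numFixed p : ℝ) / n) * ((numFixed p : ℝ) / n - 1 / n) *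
          (2 * ((numFixed p : ℝ) / n) - 1 / n) / 6) : ℝ) +
        logRemainder (Finset.range (numFixed p)) fun j =>
          ((j : ℂ) - (0 : ℕ)) * ((s / (n * b) : ℝ) * I)) := by
  have hprod := prod_range_one_add_mul_I (numFixed p) 0 (s / (n * b))
  simp only [Nat.cast_zero, sub_zero] at hprod ⊢
  rw [hprod, fixedPointShift, quadCoeff]
  congr 3
  · congr 2
    field_simp
  · congr 1
    field_simp
    ring

theorem norm_integral_mul_exp_sub_le {Ω : Type*} [MeasurableSpace Ω] {μ : Measure Ω} {w X : Ω → ℂ}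
    {g : Ω → ℝ} {M : ℝ} (hw : Integrable w μ) (hwX : Integrable (fun ω => w ω * exp (X ω)) μ)
    (hg : Integrable g μ) (hw_le : ∀ ω, ‖w ω‖ ≤ 1) (hX_le : ∀ ω, ‖X ω‖ ≤ g ω)
    (hg_le : ∀ ω, g ω ≤ M) :
    ‖∫ ω, w ω * exp (X ω) ∂μ - ∫ ω, w ω ∂μ‖ ≤ Real.exp M * ∫ ω, g ω ∂μ := by
  have hexp (ω : Ω) : ‖exp (X ω) - 1‖ ≤ ‖X ω‖ * Real.exp ‖X ω‖ := by
    simpa using norm_exp_sub_sum_le_norm_mul_exp (X ω) 1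
  rw [← integral_sub hwX hw, ← integral_const_mul]
  refine norm_integral_le_of_norm_le (hg.const_mul _) (.of_forall fun ω => ?_)
  calc ‖w ω * exp (X ω) - w ω‖ = ‖w ω‖ * ‖exp (X ω) - 1‖ := by rw [← mul_sub_one, norm_mul]
    _ ≤ 1 * (‖X ω‖ * Real.exp ‖X ω‖) := by
        gcongr
        exacts [hw_le ω, hexp ω]
    _ ≤ 1 * (g ω * Real.exp M) := by
        gcongr
        exacts [(norm_nonneg _).trans (hX_le ω), hX_le ω, (hX_le ω).trans (hg_le ω)]
    _ = Real.exp M * g ω := by rw [one_mul, mul_comm]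

theorem exp_mul_prod_descents_eq (hn : n ≠ 0) (hb : b ≠ 0) (γ δ : ℝ) (π : Equiv.Perm (Fin n)) :
    exp (-((s * (δ / b) : ℝ) * I)) *
        (∏ k ∈ Finset.range n, (1 + ((k : ℂ) - descentNumber π) * ((s / (n * b) : ℝ) * I))) *
        exp (-(quadCoeff s b n * (γ + 1 / 12)) : ℝ) =
      exp ((s * ((centredAscents π - δ) / b) : ℝ) * I) *
        exp ((quadCoeff s b n * ((centredAscents π / n) ^ 2 - γ) -
            quadCoeff s b n / (12 * n ^ 2) : ℝ) +
          logRemainder (Finset.range n) fun k =>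
            ((k : ℂ) - descentNumber π) * ((s / (n * b) : ℝ) * I)) := by
  rw [prod_descents_eq_exp hn hb, ← Complex.exp_add, ← Complex.exp_add, ← Complex.exp_add]
  congr 1
  push_cast
  ring

theorem norm_quadratic_add_logRemainder_le (hn : n ≠ 0) (hb : 0 < b) (hsb : |s| / b ≤ 1 / 2)
    (γ : ℝ) (π : Equiv.Perm (Fin n)) :
    ‖((quadCoeff s b n * ((centredAscents π / n) ^ 2 - γ) - quadCoeff s b n / (12 * n ^ 2) : ℝ) : ℂ)
        + logRemainder (Finset.range n) fun k =>
          ((k : ℂ) - descentNumber π) * ((s / (n * b) : ℝ) * I)‖ ≤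
      quadCoeff s b n * |(centredAscents π / n) ^ 2 - γ| + expansionError s b n := by
  have hκ := quadCoeff_nonneg s b n
  have hquad : ‖((quadCoeff s b n * ((centredAscents π / n) ^ 2 - γ) -
        quadCoeff s b n / (12 * n ^ 2) : ℝ) : ℂ)‖ ≤
      quadCoeff s b n * |(centredAscents π / n) ^ 2 - γ| + quadCoeff s b n / (12 * n ^ 2) := by
    rw [norm_real]
    refine (norm_sub_le _ _).trans_eq ?_
    rw [norm_mul, Real.norm_of_nonneg hκ, Real.norm_eq_abs, Real.norm_of_nonneg (by positivity)]
  rw [expansionError, ← add_assoc]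
  exact norm_add_le_of_le hquad
    (norm_logRemainder_range_le le_rfl (card_finset_fin_le (descentSet π)) hn hb hsb)

theorem norm_exp_mul_integral_prod_sub_integral_exp_le (p : n.Partition) (hn : n ≠ 0) (hb : 0 < b)
    (hsb : |s| / b ≤ 1 / 2) (γ δ : ℝ) :
    ‖exp (-((s * (δ / b) : ℝ) * I)) *
          (∫ π, ∏ k ∈ Finset.range n,
            (1 + ((k : ℂ) - descentNumber π) * ((s / (n * b) : ℝ) * I)) ∂(uniformClass p)) *
          exp (-(quadCoeff s b n * (γ + 1 / 12)) : ℝ) -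
        ∫ π, exp ((s * ((centredAscents π - δ) / b) : ℝ) * I) ∂(uniformClass p)‖ ≤
      Real.exp (quadCoeff s b n * (1 / 4 + |γ|) + expansionError s b n) *
      (quadCoeff s b n * ∫ π, |(centredAscents π / n) ^ 2 - γ| ∂(uniformClass p) +
        expansionError s b n) := by
  have hκ := quadCoeff_nonneg s b n
  have hdist (π : Equiv.Perm (Fin n)) : |(centredAscents π / n) ^ 2 - γ| ≤ 1 / 4 + |γ| := by
    refine (abs_sub _ _).trans ?_
    gcongr
    rw [abs_pow]
    exact (pow_le_pow_left₀ (abs_nonneg _) (abs_centredAscents_div_le hn π) 2).trans (by norm_num)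
  have hmean : quadCoeff s b n * ∫ π, |(centredAscents π / n) ^ 2 - γ| ∂(uniformClass p) +
        expansionError s b n =
      ∫ π, (quadCoeff s b n * |(centredAscents π / n) ^ 2 - γ| + expansionError s b n)
        ∂(uniformClass p) := by
    rw [integral_add .of_finite .of_finite, integral_const_mul, integral_const, probReal_univ,
      one_smul]
  simp only [← integral_const_mul, ← integral_mul_const, exp_mul_prod_descents_eq hn hb.ne']
  rw [integral_const_mul, hmean]
  refine norm_integral_mul_exp_sub_le .of_finite .of_finite .of_finite
    (fun π => (norm_exp_ofReal_mul_I _).le)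
    (fun π => norm_quadratic_add_logRemainder_le hn hb hsb γ π) fun π => ?_
  gcongr
  exact hdist π

end ScaledExpansion

section ScalingLimit

open MeasureTheory Complex Filter Topology

variable {n : ℕ → ℕ} {p : ∀ k, (n k).Partition} {b : ℕ → ℝ} {α c : ℝ}

theorem tendsto_remainderBound (hb : Tendsto b atTop atTop)
    (hc : Tendsto (fun k => n k / b k ^ 2) atTop (𝓝 c)) (s : ℝ) :
    Tendsto (fun k => n k * (|s| / b k) ^ 3) atTop (𝓝 0) := by
  have h := (hc.mul_const (|s| ^ 2)).mul (hb.const_div_atTop |s|)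
  rw [mul_zero] at h
  exact h.congr fun k => by ring

theorem tendsto_quadCoeff (hc : Tendsto (fun k => n k / b k ^ 2) atTop (𝓝 c)) (s : ℝ) :
    Tendsto (fun k => quadCoeff s (b k) (n k)) atTop (𝓝 (s ^ 2 * c / 2)) :=
  (hc.const_mul (s ^ 2)).div_const 2

theorem tendsto_expansionError (hn : Tendsto n atTop atTop) (hb : Tendsto b atTop atTop)
    (hc : Tendsto (fun k => n k / b k ^ 2) atTop (𝓝 c)) (s : ℝ) :
    Tendsto (fun k => expansionError s (b k) (n k)) atTop (𝓝 0) := by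
  have hinv : Tendsto (fun k => 1 / (n k : ℝ)) atTop (𝓝 0) :=
    tendsto_one_div_atTop_nhds_zero_nat.comp hn
  have h := ((tendsto_quadCoeff hc s).mul ((hinv.pow 2).div_const 12)).add
    (tendsto_remainderBound hb hc s)
  rw [zero_pow two_ne_zero, zero_div, mul_zero, add_zero] at h
  refine h.congr fun k => ?_
  rw [expansionError]
  ring

theorem eventually_pos_and_abs_div_le (hn : Tendsto n atTop atTop) (hb : Tendsto b atTop atTop)
    (s : ℝ) : ∀ᶠ k in atTop, n k ≠ 0 ∧ 0 < b k ∧ |s| / b k ≤ 1 / 2 :=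
  (hn.eventually_ne_atTop 0).and ((hb.eventually_gt_atTop 0).and
    ((hb.const_div_atTop |s|).eventually_le_const (by norm_num)))

theorem tendsto_exp_mul_prod_fixedPoints (hn : Tendsto n atTop atTop) (hb : Tendsto b atTop atTop)
    (hc : Tendsto (fun k => n k / b k ^ 2) atTop (𝓝 c))
    (hα : Tendsto (fun k => (numFixed (p k) : ℝ) / n k) atTop (𝓝 α)) (s : ℝ) :
    Tendsto (fun k => exp (-((s * (fixedPointShift (p k) / b k) : ℝ) * I)) *
        ∏ j ∈ Finset.range (numFixed (p k)), (1 + j * ((s / (n k * b k) : ℝ) * I)))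
      atTop (𝓝 (exp (s ^ 2 * c / 2 * (α ^ 3 / 3) : ℝ))) := by
  have hinv : Tendsto (fun k => 1 / (n k : ℝ)) atTop (𝓝 0) :=
    tendsto_one_div_atTop_nhds_zero_nat.comp hn
  have hquad := (tendsto_quadCoeff hc s).mul
    (((hα.mul (hα.sub hinv)).mul ((hα.const_mul 2).sub hinv)).div_const 6)
  have hrem : Tendsto (fun k => logRemainder (Finset.range (numFixed (p k))) fun j =>
      ((j : ℂ) - (0 : ℕ)) * ((s / (n k * b k) : ℝ) * I)) atTop (𝓝 0) := by
    refine squeeze_zero_norm' ?_ (tendsto_remainderBound hb hc s)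
    filter_upwards [eventually_pos_and_abs_div_le hn hb s] with k ⟨hnk, hbk, hsk⟩
    exact norm_logRemainder_range_le (numFixed_le _) (Nat.zero_le _) hnk hbk hsk
  have hlim := (continuous_exp.tendsto _).comp
    (((continuous_ofReal.tendsto _).comp hquad).add hrem)
  have hvalue : s ^ 2 * c / 2 * (α * (α - 0) * (2 * α - 0) / 6) = s ^ 2 * c / 2 * (α ^ 3 / 3) := by
    ring
  rw [add_zero, hvalue] at hlim
  refine hlim.congr' ?_
  filter_upwards [eventually_pos_and_abs_div_le hn hb s] with k ⟨hnk, hbk, _⟩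
  rw [prod_fixedPoints_eq_exp _ hnk hbk.ne', ← Complex.exp_add, add_assoc, neg_add_cancel_left]
  rfl

theorem tendsto_exp_mul_integral_prod (hn : Tendsto n atTop atTop) (hb : Tendsto b atTop atTop)
    (hc : Tendsto (fun k => n k / b k ^ 2) atTop (𝓝 c))
    (hα : Tendsto (fun k => (numFixed (p k) : ℝ) / n k) atTop (𝓝 α)) (s : ℝ) :
    Tendsto (fun k => exp (-((s * (fixedPointShift (p k) / b k) : ℝ) * I)) *
        ∫ π, ∏ j ∈ Finset.range (n k),
          (1 + ((j : ℂ) - descentNumber π) * ((s / (n k * b k) : ℝ) * I)) ∂(uniformClass (p k)))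
      atTop (𝓝 (exp (s ^ 2 * c / 2 * (α ^ 3 / 3) : ℝ))) := by
  have hfixed := tendsto_exp_mul_prod_fixedPoints hn hb hc hα s
  have hsb := hb.const_div_atTop |s|
  have hfactor : Tendsto (fun k => Real.exp (|s| / b k + (|s| / b k) ^ 2) - 1) atTop (𝓝 0) := by
    simpa using ((Real.continuous_exp.tendsto _).comp (hsb.add (hsb.pow 2))).sub_const 1
  have herror := hfixed.norm.mul hfactor
  rw [mul_zero] at herror
  refine tendsto_of_tendsto_of_dist hfixed
    (squeeze_zero' (.of_forall fun _ => dist_nonneg) ?_ herror)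
  filter_upwards [eventually_pos_and_abs_div_le hn hb s] with k ⟨hnk, hbk, hsk⟩
  set u : ℂ := (s / (n k * b k) : ℝ) * I with hu
  have hnu : n k * ‖u‖ = |s| / b k := by
    rw [hu, norm_mul, norm_I, mul_one, norm_real, Real.norm_eq_abs, abs_div, abs_mul, Nat.abs_cast,
      abs_of_pos hbk]
    field_simp
  have hu_le : ‖u‖ ≤ 1 := by
    have : (1 : ℝ) ≤ n k := mod_cast Nat.one_le_iff_ne_zero.2 hnk
    nlinarith [norm_nonneg u]
  rw [dist_comm, dist_eq_norm, ← mul_sub, norm_mul, norm_mul, mul_assoc]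
  refine mul_le_mul_of_nonneg_left ((norm_integral_prod_sub_prod_le (p k) hu_le).trans_eq ?_)
    (norm_nonneg _)
  rw [← hnu]
  congr 3
  ring

theorem tendsto_integral_exp_of_tendsto_integral_abs (hn : Tendsto n atTop atTop)
    (hb : Tendsto b atTop atTop) (hc : Tendsto (fun k => n k / b k ^ 2) atTop (𝓝 c))
    (hα : Tendsto (fun k => (numFixed (p k) : ℝ) / n k) atTop (𝓝 α)) {γ : ℝ}
    (hγ : Tendsto (fun k => n k / b k ^ 2 *
      ∫ π, |(centredAscents π / n k) ^ 2 - γ| ∂(uniformClass (p k))) atTop (𝓝 0)) (s : ℝ) :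
    Tendsto (fun k => ∫ π, exp ((s * ((centredAscents π - fixedPointShift (p k)) / b k) : ℝ) * I)
        ∂(uniformClass (p k)))
      atTop (𝓝 (exp (-(s ^ 2 * c / 2 * (γ + 1 / 12 - α ^ 3 / 3)) : ℝ))) := by
  have hκ := tendsto_quadCoeff hc s
  have hη := tendsto_expansionError hn hb hc s
  have hmean : Tendsto (fun k => quadCoeff s (b k) (n k) *
      ∫ π, |(centredAscents π / n k) ^ 2 - γ| ∂(uniformClass (p k))) atTop (𝓝 0) := by
    have h := hγ.const_mul (s ^ 2 / 2)
    rw [mul_zero] at h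
    refine h.congr fun k => ?_
    rw [quadCoeff]
    ring
  have herror := ((Real.continuous_exp.tendsto _).comp
    ((hκ.mul_const (1 / 4 + |γ|)).add hη)).mul (hmean.add hη)
  rw [add_zero, add_zero, mul_zero] at herror
  have hmain := (tendsto_exp_mul_integral_prod hn hb hc hα s).mul
    ((continuous_exp.tendsto _).comp
      ((continuous_ofReal.tendsto _).comp (hκ.mul_const (γ + 1 / 12)).neg))
  rw [← Complex.exp_add, ← ofReal_add, show s ^ 2 * c / 2 * (α ^ 3 / 3) +
    -(s ^ 2 * c / 2 * (γ + 1 / 12)) = -(s ^ 2 * c / 2 * (γ + 1 / 12 - α ^ 3 / 3)) by ring] at hmain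
  refine tendsto_of_tendsto_of_dist hmain
    (squeeze_zero' (.of_forall fun _ => dist_nonneg) ?_ herror)
  filter_upwards [eventually_pos_and_abs_div_le hn hb s] with k ⟨hnk, hbk, hsk⟩
  rw [dist_eq_norm]
  exact norm_exp_mul_integral_prod_sub_integral_exp_le (p k) hnk hbk hsk γ _

end ScalingLimit

section Concentration

open MeasureTheory ProbabilityTheory Complex Filter Topology

theorem sq_integral_abs_le_mul_one_sub_re {Ω : Type*} [MeasurableSpace Ω] {μ : Measure Ω}
    [IsProbabilityMeasure μ] {X : Ω → ℝ} (hXm : AEStronglyMeasurable X μ)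
    (hX : ∀ ω, |X ω| ≤ Real.pi) :
    (∫ ω, |X ω| ∂μ) ^ 2 ≤ Real.pi ^ 2 / 2 * (1 - (∫ ω, exp (X ω * I) ∂μ).re) := by
  have habs : MemLp (fun ω => |X ω|) 2 μ :=
    (MemLp.of_bound hXm Real.pi (.of_forall hX)).abs
  have hexp : Integrable (fun ω => exp (X ω * I)) μ :=
    .of_bound (by fun_prop) 1 (.of_forall fun ω => (norm_exp_ofReal_mul_I _).le)
  have hre : (∫ ω, exp (X ω * I) ∂μ).re = ∫ ω, Real.cos (X ω) ∂μ := by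
    simpa only [RCLike.re_to_complex, exp_ofReal_mul_I_re] using (integral_re hexp).symm
  have hcos : Integrable (fun ω => Real.cos (X ω)) μ := by
    simpa only [RCLike.re_to_complex, exp_ofReal_mul_I_re] using hexp.re
  have hpoint (x : ℝ) (hx : |x| ≤ Real.pi) : x ^ 2 ≤ Real.pi ^ 2 / 2 * (1 - Real.cos x) := by
    calc x ^ 2 = Real.pi ^ 2 / 2 * (2 / Real.pi ^ 2 * x ^ 2) := by field_simp
      _ ≤ Real.pi ^ 2 / 2 * (1 - Real.cos x) := by
          gcongr
          linarith [Real.cos_le_one_sub_mul_cos_sq hx]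
  calc (∫ ω, |X ω| ∂μ) ^ 2 ≤ ∫ ω, |X ω| ^ 2 ∂μ := by
        have hvar := variance_nonneg (fun ω => |X ω|) μ
        rw [variance_eq_sub habs] at hvar
        exact sub_nonneg.1 hvar
    _ ≤ ∫ ω, Real.pi ^ 2 / 2 * (1 - Real.cos (X ω)) ∂μ :=
        integral_mono habs.integrable_sq (((integrable_const 1).sub hcos).const_mul _) fun ω => by
          simpa only [sq_abs] using hpoint (X ω) (hX ω)
    _ = Real.pi ^ 2 / 2 * (1 - (∫ ω, exp (X ω * I) ∂μ).re) := by
        rw [integral_const_mul, integral_sub (integrable_const 1) hcos, integral_const,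
          probReal_univ, one_smul, hre]

theorem tendsto_integral_abs_of_tendsto_integral_exp {ι : Type*} {l : Filter ι} {Ω : ι → Type*}
    [∀ i, MeasurableSpace (Ω i)] {μ : ∀ i, Measure (Ω i)} [∀ i, IsProbabilityMeasure (μ i)]
    {X : ∀ i, Ω i → ℝ} (hXm : ∀ i, AEStronglyMeasurable (X i) (μ i))
    (hX : ∀ᶠ i in l, ∀ ω, |X i ω| ≤ Real.pi)
    (hexp : Tendsto (fun i => ∫ ω, exp (X i ω * I) ∂(μ i)) l (𝓝 1)) :
    Tendsto (fun i => ∫ ω, |X i ω| ∂(μ i)) l (𝓝 0) := by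
  have hbound := ((((continuous_re.tendsto _).comp hexp).const_sub 1).const_mul
    (Real.pi ^ 2 / 2)).sqrt
  rw [one_re, sub_self, mul_zero, Real.sqrt_zero] at hbound
  refine squeeze_zero' (.of_forall fun i => integral_nonneg fun ω => abs_nonneg _) ?_ hbound
  filter_upwards [hX] with i hXi
  exact Real.le_sqrt_of_sq_le (sq_integral_abs_le_mul_one_sub_re (hXm i) hXi)

theorem abs_fixedPointShift_div_le {n : ℕ} (p : n.Partition) : |fixedPointShift p / n| ≤ 1 / 2 := by
  have hle : (numFixed p : ℝ) ≤ n := mod_cast numFixed_le p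
  rcases Nat.eq_zero_or_pos (numFixed p) with hzero | hpos
  · simp [fixedPointShift, hzero]
  have hone : (1 : ℝ) ≤ numFixed p := mod_cast hpos
  have hn : (0 : ℝ) < n := by linarith
  have hnonneg : 0 ≤ (numFixed p : ℝ) * (numFixed p - 1) :=
    mul_nonneg (by linarith) (by linarith)
  rw [fixedPointShift, div_div, abs_of_nonneg (div_nonneg hnonneg (by positivity)),
    div_le_iff₀ (by positivity)]
  nlinarith

variable {n : ℕ → ℕ} {p : ∀ k, (n k).Partition} {α : ℝ}

theorem tendsto_fixedPointShift_div (hn : Tendsto n atTop atTop)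
    (hα : Tendsto (fun k => (numFixed (p k) : ℝ) / n k) atTop (𝓝 α)) :
    Tendsto (fun k => fixedPointShift (p k) / n k) atTop (𝓝 (α ^ 2 / 2)) := by
  have hinv : Tendsto (fun k => 1 / (n k : ℝ)) atTop (𝓝 0) :=
    tendsto_one_div_atTop_nhds_zero_nat.comp hn
  have h := (hα.mul (hα.sub hinv)).div_const 2
  rw [sub_zero, ← sq] at h
  refine h.congr fun k => ?_
  rw [fixedPointShift]
  ring

theorem tendsto_integral_abs_centredAscents_sub_shift_div (hn : Tendsto n atTop atTop)
    (hα : Tendsto (fun k => (numFixed (p k) : ℝ) / n k) atTop (𝓝 α)) :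
    Tendsto (fun k => ∫ π, |(centredAscents π - fixedPointShift (p k)) / n k| ∂(uniformClass (p k)))
      atTop (𝓝 0) := by
  have hb : Tendsto (fun k => (n k : ℝ)) atTop atTop := tendsto_natCast_atTop_atTop.comp hn
  have hinv : Tendsto (fun k => (n k : ℝ) / (n k : ℝ) ^ 2) atTop (𝓝 0) :=
    hb.inv_tendsto_atTop.congr fun k => by simp [sq]
  have hquad : Tendsto (fun k => (n k : ℝ) / (n k : ℝ) ^ 2 *
      ∫ π, |(centredAscents π / n k) ^ 2 - 0| ∂(uniformClass (p k))) atTop (𝓝 0) := by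
    refine hinv.zero_mul_isBoundedUnder_le (isBoundedUnder_of_eventually_le (a := 1) ?_)
    filter_upwards [hn.eventually_ne_atTop 0] with k hk
    refine (norm_integral_le_of_norm_le_const (C := 1) (.of_forall fun π => ?_)).trans_eq (by simp)
    rw [Real.norm_eq_abs, abs_abs, sub_zero, abs_pow]
    exact pow_le_one₀ (abs_nonneg _) ((abs_centredAscents_div_le hk π).trans (by norm_num))
  have hexp := tendsto_integral_exp_of_tendsto_integral_abs hn hb hinv hα hquad 1
  simp only [one_mul, mul_zero, zero_div, zero_mul, neg_zero, ofReal_zero, Complex.exp_zero] at hexp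
  refine tendsto_integral_abs_of_tendsto_integral_exp
    (fun k => Measurable.of_discrete.aestronglyMeasurable) ?_ hexp
  filter_upwards [hn.eventually_ne_atTop 0] with k hk π
  rw [sub_div]
  linarith [abs_sub (centredAscents π / n k) (fixedPointShift (p k) / n k),
    abs_centredAscents_div_le hk π, abs_fixedPointShift_div_le (p k), Real.pi_gt_three]

theorem limit_mem_Icc (hα : Tendsto (fun k => (numFixed (p k) : ℝ) / n k) atTop (𝓝 α)) :
    α ∈ Set.Icc 0 1 :=
  isClosed_Icc.mem_of_tendsto hα (.of_forall fun k => ⟨by positivity,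
    div_le_one_of_le₀ (mod_cast numFixed_le (p k)) (Nat.cast_nonneg _)⟩)

theorem tendsto_integral_abs_centredAscents_div_sq_sub (hn : Tendsto n atTop atTop)
    (hα : Tendsto (fun k => (numFixed (p k) : ℝ) / n k) atTop (𝓝 α)) :
    Tendsto (fun k => ∫ π, |(centredAscents π / n k) ^ 2 - α ^ 4 / 4| ∂(uniformClass (p k)))
      atTop (𝓝 0) := by
  obtain ⟨hα_nonneg, hα_le⟩ := limit_mem_Icc hα
  have hbound := (tendsto_integral_abs_centredAscents_sub_shift_div hn hα).add
    ((tendsto_fixedPointShift_div hn hα).sub_const (α ^ 2 / 2)).abs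
  rw [sub_self, abs_zero, add_zero] at hbound
  refine squeeze_zero' (.of_forall fun k => integral_nonneg fun π => abs_nonneg _) ?_ hbound
  filter_upwards [hn.eventually_ne_atTop 0] with k hk
  set δ := fixedPointShift (p k)
  have hmean : ∫ π, |(centredAscents π - δ) / n k| ∂(uniformClass (p k)) + |δ / n k - α ^ 2 / 2| =
      ∫ π, (|(centredAscents π - δ) / n k| + |δ / n k - α ^ 2 / 2|) ∂(uniformClass (p k)) := by
    rw [integral_add .of_finite .of_finite, integral_const, probReal_univ, one_smul]
  rw [hmean]
  refine integral_mono .of_finite .of_finite fun π => ?_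
  have hsum : |centredAscents π / n k + α ^ 2 / 2| ≤ 1 := by
    have hA := abs_le.1 (abs_centredAscents_div_le hk π)
    rw [abs_le]
    constructor <;> nlinarith
  calc |(centredAscents π / n k) ^ 2 - α ^ 4 / 4|
      = |centredAscents π / n k - α ^ 2 / 2| * |centredAscents π / n k + α ^ 2 / 2| := by
        rw [← abs_mul]
        ring_nf
    _ ≤ |centredAscents π / n k - α ^ 2 / 2| := mul_le_of_le_one_right (abs_nonneg _) hsum
    _ ≤ |(centredAscents π - δ) / n k| + |δ / n k - α ^ 2 / 2| := by
        rw [sub_div]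
        exact abs_sub_le _ _ _

end Concentration

section CharacteristicFunction

open MeasureTheory Complex Filter Topology

variable {n : ℕ → ℕ} {p : ∀ k, (n k).Partition} {α : ℝ}

theorem tendsto_integral_exp_centredAscents_sub_shift_div_sqrt (hn : Tendsto n atTop atTop)
    (hα : Tendsto (fun k => (numFixed (p k) : ℝ) / n k) atTop (𝓝 α)) (s : ℝ) :
    Tendsto (fun k => ∫ π, exp ((s * ((centredAscents π - fixedPointShift (p k)) / √(n k)) : ℝ) * I)
        ∂(uniformClass (p k)))
      atTop (𝓝 (exp (-(s ^ 2 / 2 * ((1 - 4 * α ^ 3 + 3 * α ^ 4) / 12)) : ℝ))) := by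
  have hsqrt : Tendsto (fun k => √(n k : ℝ)) atTop atTop :=
    Real.tendsto_sqrt_atTop.comp (tendsto_natCast_atTop_atTop.comp hn)
  have hratio : ∀ᶠ k in atTop, (n k : ℝ) / √(n k : ℝ) ^ 2 = 1 := by
    filter_upwards [hn.eventually_ne_atTop 0] with k hk
    rw [Real.sq_sqrt (Nat.cast_nonneg _), div_self (Nat.cast_ne_zero.2 hk)]
  have hone : Tendsto (fun k => (n k : ℝ) / √(n k : ℝ) ^ 2) atTop (𝓝 1) :=
    tendsto_const_nhds.congr' (hratio.mono fun k hk => hk.symm)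
  have hquad := hone.mul (tendsto_integral_abs_centredAscents_div_sq_sub hn hα)
  rw [one_mul] at hquad
  have hlim := tendsto_integral_exp_of_tendsto_integral_abs hn hsqrt hone hα hquad s
  rwa [show s ^ 2 * 1 / 2 * (α ^ 4 / 4 + 1 / 12 - α ^ 3 / 3) =
    s ^ 2 / 2 * ((1 - 4 * α ^ 3 + 3 * α ^ 4) / 12) by ring] at hlim

theorem normDescents_eq {n : ℕ} (p : n.Partition) (π : Equiv.Perm (Fin n)) :
    normDescents p π = -((centredAscents π - fixedPointShift p) / √n) +
      ((numFixed p : ℝ) / n / 2 - 1) / √n := by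
  rw [normDescents, centredAscents, fixedPointShift]
  ring

theorem tendsto_charFun_map_normDescents (hn : Tendsto n atTop atTop)
    (hα : Tendsto (fun k => (numFixed (p k) : ℝ) / n k) atTop (𝓝 α)) (t : ℝ) :
    Tendsto (fun k => charFun ((uniformClass (p k)).map (normDescents (p k))) t)
      atTop (𝓝 (exp (-(t ^ 2 / 2 * ((1 - 4 * α ^ 3 + 3 * α ^ 4) / 12)) : ℝ))) := by
  have hcorrection : Tendsto (fun k => ((numFixed (p k) : ℝ) / n k / 2 - 1) / √(n k : ℝ))
      atTop (𝓝 0) :=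
    ((hα.div_const 2).sub_const 1).div_atTop
      (Real.tendsto_sqrt_atTop.comp (tendsto_natCast_atTop_atTop.comp hn))
  have hphase : Tendsto (fun k =>
      exp ((t * (((numFixed (p k) : ℝ) / n k / 2 - 1) / √(n k : ℝ)) : ℝ) * I)) atTop (𝓝 1) := by
    have h := (continuous_exp.tendsto _).comp
      (((continuous_ofReal.tendsto _).comp (hcorrection.const_mul t)).mul_const I)
    rwa [mul_zero, ofReal_zero, zero_mul, Complex.exp_zero] at h
  have hlim := hphase.mul (tendsto_integral_exp_centredAscents_sub_shift_div_sqrt hn hα (-t))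
  rw [one_mul, neg_sq] at hlim
  refine hlim.congr fun k => ?_
  rw [charFun_apply_real, integral_map Measurable.of_discrete.aemeasurable (by fun_prop),
    ← integral_const_mul]
  refine integral_congr_ae (.of_forall fun π => ?_)
  simp only [normDescents_eq, ← Complex.exp_add]
  congr 1
  push_cast
  ring

end CharacteristicFunction

/-- Along any sequence of partitions `p k` of `n k` with `n k → ∞` and `m₁ / n → α`, the
normalized descent numbers of uniform elements of the conjugacy classes converge in distribution to
the centred normal law of variance `(1 - 4 α ^ 3 + 3 α ^ 4) / 12`. This number equals
`(1 - α) ^ 2 * (1 + 2 α + 3 α ^ 2) / 12 ≥ 0`, so `Real.toNNReal` does not truncate it; for `α = 1`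
the limit law is the Dirac mass at `0`. -/
theorem theorem1p3 (n : ℕ → ℕ) (p : ∀ k, (n k).Partition) (α : ℝ)
    (hn : Filter.Tendsto n Filter.atTop Filter.atTop)
    (hα : Filter.Tendsto (fun k => (numFixed (p k) : ℝ) / (n k : ℝ)) Filter.atTop (nhds α)) :
    MeasureTheory.TendstoInDistribution
      (fun k => normDescents (p k)) Filter.atTop (id : ℝ → ℝ)
      (fun k => uniformClass (p k))
      (ProbabilityTheory.gaussianReal 0
        (Real.toNNReal ((1 - 4 * α ^ 3 + 3 * α ^ 4) / 12))) := by
  have hvar : 0 ≤ (1 - 4 * α ^ 3 + 3 * α ^ 4) / 12 := by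
    rw [show 1 - 4 * α ^ 3 + 3 * α ^ 4 = (1 - α) ^ 2 * (2 * α ^ 2 + (1 + α) ^ 2) by ring]
    positivity
  refine ⟨fun k => Measurable.of_discrete.aemeasurable, aemeasurable_id, ?_⟩
  refine MeasureTheory.ProbabilityMeasure.tendsto_iff_tendsto_charFun.2 fun t => ?_
  have hgauss : MeasureTheory.charFun ((ProbabilityTheory.gaussianReal 0
        (Real.toNNReal ((1 - 4 * α ^ 3 + 3 * α ^ 4) / 12))).map id) t =
      Complex.exp (-(t ^ 2 / 2 * ((1 - 4 * α ^ 3 + 3 * α ^ 4) / 12)) : ℝ) := by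
    rw [MeasureTheory.Measure.map_id, ProbabilityTheory.charFun_gaussianReal,
      Real.coe_toNNReal _ hvar]
    congr 1
    push_cast
    ring
  simpa only [MeasureTheory.ProbabilityMeasure.coe_mk, hgauss] using
    tendsto_charFun_map_normDescents hn hα t
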